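/- Let $m\ge 1$ be an integer, $[m]=\{1,\dots,m\}$, let $u$ be the uniform distribution on $[m]$, and let $\varepsilon>0$, $\delta\in(0,1)$. For a distribution $q$ on $[m]$ write $\|q-u\|_1=\sum_{i=1}^m|q_i-1/m|$, and let $\mathcal C(\varepsilon)=\{q:\|q-u\|_1>\varepsilon\}$. From an i.i.d. sequence $X_1,X_2,\dots$ of samples in $[m]$ one has to decide between $H_0$ (the samples have distribution $u$) and $H_1$ (the samples have some unknown distribution $p\in\mathcal C(\varepsilon)$). Let $K_1(n)$ be the number of symbols of $[m]$ that appear exactly once among $X_1,\dots,X_n$, and let $c_u(n)$ be the expectation of $K_1(n)$ when the samples have distribution $u$. The *Sequential Coincidence Test* (SCT) with input $m,\varepsilon,\delta$ runs through the epochs $k=1,2,\dots$ as long as $k\le 112\,\varepsilon^{-2}$. In epoch $k$ it takes further samples until it has $n_k=\left\lceil k\sqrt{m\log(k+2/\delta)}\right\rceil$ samples in total; if $c_u(n_k)-K_1(n_k)>\tau_k:=7n_k\sqrt{\log(k+2/\delta)/m}$, it stops and declares $H_1$, and otherwise it goes on to epoch $k+1$. If all epochs $k\le 112\,\varepsilon^{-2}$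 pass without a declaration of $H_1$, it stops and declares $H_0$. **Theorem.** There are universal constants $c,C>0$ such that the following holds for all integers $m\ge1$ and all $\varepsilon>0$, $\delta\in(0,1)$ with $$m>m_0:=\min\left\{l\in\{1,2,3,\dots\}: 1123\, l^{1/4}e^{-0.25\sqrt l}\le\delta\varepsilon^2\right\}\quad\text{and}\quad \varepsilon\ge c\,m^{-1/8}.$$ 1. If the samples have a distribution $p\in\mathcal C(\varepsilon)$ with $\|p-u\|_1=\gamma$, then the expected number of samples taken by SCT is at most $C\,\frac{\sqrt m}{\gamma^2}\sqrt{\log\left(\frac1\gamma+\frac1\delta\right)}$. 2. If the samples have distribution $u$, then the expected number of samples taken by SCT is at most $C\,\frac{\sqrt m}{\varepsilon^2}\sqrt{\log\left(\frac1\varepsilon+\frac1\delta\right)}$. 3. SCT declares $H_1$ with probability at least $1-\delta$ if the samples have a distribution $p\in\mathcal C(\varepsilon)$, and it declares $H_0$ with probability at least $1-\delta$ if the samples have distribution $u$. -/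

import Mathlib

open MeasureTheory

noncomputable section

namespace SCT

/-- The law of an infinite sequence of i.i.d. samples drawn from the distribution `p` on `[m]`. -/
def sampleLaw {m : ℕ} (p : PMF (Fin m)) : Measure (ℕ → Fin m) :=
  Measure.infinitePi (fun _ : ℕ => p.toMeasure)

/-- The uniform distribution on `[m]`. -/
def unif (m : ℕ) [NeZero m] : PMF (Fin m) := PMF.uniformOfFintype (Fin m)

/-- The `ℓ¹` distance of `p` to the uniform distribution on `[m]`. -/
def distUnif {m : ℕ} (p : PMF (Fin m)) : ℝ :=
  ∑ j : Fin m, |(p j).toReal - 1 / (m : ℝ)|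

/-- The composite alternative: the distributions on `[m]` at `ℓ¹` distance more than `ε` from
uniform. -/
def alternatives (m : ℕ) (ε : ℝ) : Set (PMF (Fin m)) := {q | ε < distUnif q}

/-- The coincidence number of the first `n` samples of `ω`: the number of symbols in `[m]` that
appear exactly once among them. -/
def K1 {m : ℕ} (n : ℕ) (ω : ℕ → Fin m) : ℕ :=
  (Finset.univ.filter fun j : Fin m =>
    ((Finset.range n).filter fun i => ω i = j).card = 1).card

/-- The expected coincidence number of `n` i.i.d. uniform samples. -/
def cu (m : ℕ) [NeZero m] (n : ℕ) : ℝ :=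
  ∫ ω, (K1 n ω : ℝ) ∂(sampleLaw (unif m))

/-- The total number of samples available at the end of epoch `k`. -/
def nSamples (m : ℕ) (δ : ℝ) (k : ℕ) : ℕ :=
  ⌈(k : ℝ) * √((m : ℝ) * Real.log ((k : ℝ) + 2 / δ))⌉₊

/-- The threshold used at the end of epoch `k`. -/
def threshold (m : ℕ) (δ : ℝ) (k : ℕ) : ℝ :=
  7 * (nSamples m δ k : ℝ) * √(Real.log ((k : ℝ) + 2 / δ) / (m : ℝ))

/-- The two possible declarations of a test. -/
inductive Decision
  | H0
  | H1

open Classical in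
/-- The main loop of the test on the sample sequence `ω`. The arguments are the number of epochs
that are still allowed, the index `k` of the next epoch and the number `t` of samples taken so far;
the result is the declaration together with the number of samples taken in total. -/
def loop (m : ℕ) [NeZero m] (δ : ℝ) (ω : ℕ → Fin m) : ℕ → ℕ → ℕ → Decision × ℕ
  | 0, _, t => (Decision.H0, t)
  | r + 1, k, _ =>
    if cu m (nSamples m δ k) - (K1 (nSamples m δ k) ω : ℝ) > threshold m δ k then
      (Decision.H1, nSamples m δ k)
    else
      loop m δ ω r (k + 1) (nSamples m δ k)

/-- The Sequential Coincidence Test. It starts at epoch `k = 1` with no samples and runs while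
`k ≤ 112 / ε ^ 2`, that is, for at most `⌊112 / ε ^ 2⌋` epochs. -/
def run (m : ℕ) [NeZero m] (ε δ : ℝ) (ω : ℕ → Fin m) : Decision × ℕ :=
  loop m δ ω ⌊112 / ε ^ 2⌋₊ 1 0

/-- The declaration of the test. -/
def output (m : ℕ) [NeZero m] (ε δ : ℝ) (ω : ℕ → Fin m) : Decision := (run m ε δ ω).1

/-- The number of samples that the test takes. -/
def sampleCount (m : ℕ) [NeZero m] (ε δ : ℝ) (ω : ℕ → Fin m) : ℕ := (run m ε δ ω).2

/-- The least admissible support size: the least positive integer `l` with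
`1123 * l ^ (1/4) * exp (-√l / 4) ≤ δ * ε ^ 2`. -/
def m0 (ε δ : ℝ) : ℕ :=
  sInf {l : ℕ | 0 < l ∧
    1123 * (l : ℝ) ^ (1 / 4 : ℝ) * Real.exp (-(1 / 4) * √(l : ℝ)) ≤ δ * ε ^ 2}

end SCT

end

noncomputable section

namespace SCT

/-! The test statistic is centred at `n`: `n - K1` counts the samples that share their symbol with
another sample. It is a sum over the symbols of an increasing function of the count. Multinomial
counts are negatively associated, so its moment generating function is at most the product of the
binomial ones (`multiExp_prod_le`, `mgf_collisions_le`), and Chernoff bounds apply as if the counts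
were independent.

Write L = log(k + 2/δ). In epoch k, n²/m is about k²L and the threshold is about 7kL. Under the
uniform law, tilting by 1/(2k) gives a false alarm probability of at most exp(-2L) = (k + 2/δ)^(-2)
(`false_alarm_le`); these sum to at most δ/2. Under p at distance γ, convexity and Cauchy–Schwarz
add an excess of order γ²n²/m, about k²γ²L, to the expected number of collisions
(`sum_mul_one_sub_exp_ge`). It outweighs the threshold once kγ² ≥ 56, and tilting by -1/k then
bounds the probability of a miss by exp(-4L) = (k + 2/δ)^(-4) (`missed_detection_le`).

The limit 112/ε² leaves room for an epoch with kγ² ≥ 56, so the last epoch alone detects p. Beyond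
k₀ = ⌈56/γ²⌉ the misses are so rare that later epochs add at most √m expected samples to n_{k₀}.
Under the uniform law the sample size of the last epoch is already a sufficient bound. The
conditions on `m` and `ε` serve to make n at most m/500 in every epoch. -/

/-- The vector of the numbers of occurrences of the symbols among the first `n` samples. -/
def counts {m : ℕ} (n : ℕ) (ω : ℕ → Fin m) : Fin m → ℕ :=
  fun j => ((Finset.range n).filter fun i => ω i = j).card

/-- The expectation of `F` under the multinomial distribution with `n` trials and weights `q`. -/
def multiExp {m : ℕ} (q : Fin m → ℝ) : ℕ → ((Fin m → ℕ) → ℝ) → ℝ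
  | 0, F => F 0
  | n + 1, F => ∑ i, q i * multiExp q n fun c => F (c + Pi.single i 1)

/-- The expectation of `f` under the binomial distribution with parameters `n` and `x`. -/
def binExp (x : ℝ) : ℕ → (ℕ → ℝ) → ℝ
  | 0, f => f 0
  | n + 1, f => (1 - x) * binExp x n f + x * binExp x n fun r => f (r + 1)

/-! ### The multinomial law of the counts -/

instance {m : ℕ} (p : PMF (Fin m)) : IsProbabilityMeasure (sampleLaw p) := by
  unfold sampleLaw; infer_instance

lemma counts_zero {m : ℕ} (ω : ℕ → Fin m) : counts 0 ω = 0 := by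
  ext j; simp [counts]

lemma counts_succ {m : ℕ} (n : ℕ) (ω : ℕ → Fin m) :
    counts (n + 1) ω = counts n ω + Pi.single (ω n) 1 := by
  ext j
  simp only [counts, Finset.range_add_one, Finset.filter_insert, Pi.add_apply]
  split_ifs with h
  · subst h; simp
  · rw [Pi.single_eq_of_ne (Ne.symm h)]; simp

lemma counts_congr {m n : ℕ} {ω ω' : ℕ → Fin m} (h : ∀ i < n, ω i = ω' i) :
    counts n ω = counts n ω' := by
  ext j
  simp only [counts]
  congr 1
  refine Finset.filter_congr fun i hi => ?_
  rw [h i (Finset.mem_range.mp hi)]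

/-- Every function of the counts factors through the first `n` samples. -/
lemma exists_counts_eq {m : ℕ} [NeZero m] (n : ℕ) : ∃ g : (Finset.range n → Fin m) → Fin m → ℕ,
    ∀ ω : ℕ → Fin m, counts n ω = g fun i => ω i := by
  -- The value 0 beyond the first `n` samples is a dummy; `counts n` never reads it.
  refine ⟨fun x => counts n fun i => if h : i ∈ Finset.range n then x ⟨i, h⟩ else 0, fun ω => ?_⟩
  refine counts_congr fun i hi => ?_
  simp [hi]

lemma measurable_counts {m : ℕ} [NeZero m] (n : ℕ) {α : Type*} [MeasurableSpace α]
    (F : (Fin m → ℕ) → α) : Measurable fun ω : ℕ → Fin m => F (counts n ω) := by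
  obtain ⟨g, hg⟩ := exists_counts_eq (m := m) n
  simp_rw [hg]
  exact (Measurable.of_discrete (f := fun x => F (g x))).comp
    (measurable_pi_lambda _ fun i => measurable_pi_apply _)

lemma integrable_counts {m : ℕ} [NeZero m] (n : ℕ) (p : PMF (Fin m)) (F : (Fin m → ℕ) → ℝ) :
    Integrable (fun ω => F (counts n ω)) (sampleLaw p) := by
  obtain ⟨g, hg⟩ := exists_counts_eq (m := m) n
  obtain ⟨B, hB⟩ := (Set.finite_range fun x => ‖F (g x)‖).bddAbove
  refine Integrable.of_bound (measurable_counts n F).aestronglyMeasurable B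
    (Filter.Eventually.of_forall fun ω => ?_)
  rw [hg]
  exact hB ⟨_, rfl⟩

lemma integral_indicator_eval {m : ℕ} (p : PMF (Fin m)) (n : ℕ) (j : Fin m) :
    ∫ ω, (if ω n = j then (1 : ℝ) else 0) ∂(sampleLaw p) = (p j).toReal := by
  have h : (fun ω : ℕ → Fin m => if ω n = j then (1 : ℝ) else 0) =
      Set.indicator {ω | ω n = j} 1 := by
    ext ω; simp [Set.indicator_apply]
  have hm : MeasurableSet {ω : ℕ → Fin m | ω n = j} :=
    (measurable_pi_apply (X := fun _ : ℕ => Fin m) n) (measurableSet_singleton j)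
  rw [h, integral_indicator_one hm]
  have := (measurePreserving_eval_infinitePi (fun _ : ℕ => p.toMeasure) n).measure_preimage
    (measurableSet_singleton j).nullMeasurableSet
  rw [measureReal_def]
  congr 1
  rw [PMF.toMeasure_apply_singleton _ _ (measurableSet_singleton j)] at this
  exact this

/-- Conditioning on sample `n`, which is independent of the counts of the samples before it,
reproduces the recursion of `multiExp`. -/
lemma integral_counts {m : ℕ} [NeZero m] (p : PMF (Fin m)) (n : ℕ) (F : (Fin m → ℕ) → ℝ) :
    ∫ ω, F (counts n ω) ∂(sampleLaw p) = multiExp (fun j => (p j).toReal) n F := by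
  induction n generalizing F with
  | zero => simp [counts_zero, multiExp]
  | succ n ih =>
    have hsum (ω : ℕ → Fin m) : F (counts (n + 1) ω) =
        ∑ i, (if ω n = i then (1 : ℝ) else 0) * F (counts n ω + Pi.single i 1) := by
      rw [counts_succ]; simp
    simp_rw [hsum]
    have hind : ProbabilityTheory.iIndepFun (fun (i : ℕ) (ω : ℕ → Fin m) => ω i) (sampleLaw p) :=
      ProbabilityTheory.iIndepFun_infinitePi (P := fun _ : ℕ => p.toMeasure)
        (X := fun _ x => x) (fun _ => measurable_id)
    have hfin := hind.indepFun_finset {n} (Finset.range n) (by simp) fun i => measurable_pi_apply i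
    obtain ⟨g, hg⟩ := exists_counts_eq (m := m) n
    have hmul (i : Fin m) : ∫ ω, (if ω n = i then (1 : ℝ) else 0) *
        F (counts n ω + Pi.single i 1) ∂(sampleLaw p) =
        (p i).toReal * ∫ ω, F (counts n ω + Pi.single i 1) ∂(sampleLaw p) := by
      rw [← integral_indicator_eval p n i]
      refine ProbabilityTheory.IndepFun.integral_fun_mul_eq_mul_integral ?_ ?_ ?_
      · have := hfin.comp
          (φ := fun x => if x ⟨n, by simp⟩ = i then (1 : ℝ) else 0)
          (ψ := fun x => F (g x + Pi.single i 1)) Measurable.of_discrete Measurable.of_discrete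
        simp_rw [hg]
        exact this
      · refine (Measurable.aestronglyMeasurable ?_)
        exact (Measurable.of_discrete (f := fun x : Fin m => if x = i then (1 : ℝ) else 0)).comp
          (measurable_pi_apply n)
      · exact (measurable_counts n fun c => F (c + Pi.single i 1)).aestronglyMeasurable
    rw [integral_finsetSum]
    · rw [multiExp]
      refine Finset.sum_congr rfl fun i _ => ?_
      rw [hmul]
      exact congrArg _ (ih fun c => F (c + Pi.single i 1))
    · intro i _
      have h : (fun ω : ℕ → Fin m => (if ω n = i then (1 : ℝ) else 0) *
          F (counts n ω + Pi.single i 1)) =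
          Set.indicator {ω | ω n = i} fun ω => F (counts n ω + Pi.single i 1) := by
        ext ω; simp [Set.indicator_apply]
      rw [h]
      exact (integrable_counts n p fun c => F (c + Pi.single i 1)).indicator
        (measurable_pi_apply n (measurableSet_singleton i))

/-! ### Binomial expectations -/

lemma binExp_add (x : ℝ) (n : ℕ) (f g : ℕ → ℝ) :
    binExp x n (fun r => f r + g r) = binExp x n f + binExp x n g := by
  induction n generalizing f g with
  | zero => simp [binExp]
  | succ n ih => simp only [binExp, ih f g, ih (fun r => f (r + 1)) fun r => g (r + 1)]; ring

lemma binExp_const_mul (x a : ℝ) (n : ℕ) (f : ℕ → ℝ) :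
    binExp x n (fun r => a * f r) = a * binExp x n f := by
  induction n generalizing f with
  | zero => simp [binExp]
  | succ n ih => simp only [binExp, ih f, ih fun r => f (r + 1)]; ring

lemma binExp_pow (x z : ℝ) (n : ℕ) : binExp x n (fun r => z ^ r) = (1 - x + x * z) ^ n := by
  induction n with
  | zero => simp [binExp]
  | succ n ih =>
    have h : (fun r => z ^ (r + 1)) = fun r => z * z ^ r := by ext r; ring
    rw [binExp, h, binExp_const_mul, ih]; ring

lemma binExp_zero_fun (x : ℝ) (n : ℕ) : binExp x n (fun _ => 0) = 0 := by
  have := binExp_const_mul x 0 n fun _ => 0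
  simpa only [zero_mul] using this

lemma binExp_eq_zero_indicator (x : ℝ) (n : ℕ) :
    binExp x n (fun r => if r = 0 then 1 else 0) = (1 - x) ^ n := by
  induction n with
  | zero => simp [binExp]
  | succ n ih =>
    have h : (fun r : ℕ => if r + 1 = 0 then (1 : ℝ) else 0) = fun _ => 0 := by ext r; simp
    rw [binExp, ih, h, binExp_zero_fun]; ring

lemma binExp_eq_one_indicator (x : ℝ) (n : ℕ) :
    binExp x n (fun r => if r = 1 then 1 else 0) = n * x * (1 - x) ^ (n - 1) := by
  induction n with
  | zero => simp [binExp]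
  | succ n ih =>
    have h : (fun r => if r + 1 = 1 then (1 : ℝ) else 0) = fun r => if r = 0 then 1 else 0 := by
      ext r; simp
    rw [binExp, h, ih, binExp_eq_zero_indicator]
    cases n with
    | zero => simp
    | succ n => push_cast; ring

lemma binExp_mono {x : ℝ} (h0 : 0 ≤ x) (h1 : x ≤ 1) (n : ℕ) {f g : ℕ → ℝ} (h : ∀ r, f r ≤ g r) :
    binExp x n f ≤ binExp x n g := by
  induction n generalizing f g with
  | zero => exact h 0
  | succ n ih =>
    exact add_le_add (mul_le_mul_of_nonneg_left (ih h) (by linarith))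
      (mul_le_mul_of_nonneg_left (ih fun r => h (r + 1)) h0)

lemma binExp_pos {x : ℝ} (h0 : 0 ≤ x) (h1 : x ≤ 1) (n : ℕ) {f : ℕ → ℝ} (h : ∀ r, 0 < f r) :
    0 < binExp x n f := by
  induction n generalizing f with
  | zero => exact h 0
  | succ n ih =>
    rw [binExp]
    rcases h0.eq_or_lt with rfl | h0
    · simpa using ih h
    · have := ih h
      have := ih fun r => h (r + 1)
      have : 0 ≤ 1 - x := by linarith
      positivity

/-! ### Marginals and negative association -/

/-- The marginal distributions of a multinomial distribution are binomial. -/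
lemma multiExp_apply {m : ℕ} {q : Fin m → ℝ} (hq : ∑ i, q i = 1) (n : ℕ) (j : Fin m)
    (f : ℕ → ℝ) : multiExp q n (fun c => f (c j)) = binExp (q j) n f := by
  induction n generalizing f with
  | zero => simp [multiExp, binExp]
  | succ n ih =>
    -- A draw of `j` raises the count; all other symbols, of total weight `1 - q j`, leave it
    -- unchanged.
    rw [multiExp, binExp, ← Finset.add_sum_erase _ _ (Finset.mem_univ j)]
    have h1 : (fun c : Fin m → ℕ => f ((c + Pi.single j 1 : Fin m → ℕ) j)) = fun c => f (c j + 1) := by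
      ext c; simp
    have h2 : ∑ i ∈ Finset.univ.erase j,
        q i * multiExp q n (fun c => f ((c + Pi.single i 1 : Fin m → ℕ) j)) =
        ∑ i ∈ Finset.univ.erase j, q i * binExp (q j) n f := by
      refine Finset.sum_congr rfl fun i hi => ?_
      rw [← ih]
      congr 3
      ext c
      simp [Pi.single_eq_of_ne (Finset.ne_of_mem_erase hi).symm]
    rw [h1, h2, ← Finset.sum_mul, ih fun r => f (r + 1)]
    have h3 : ∑ i ∈ Finset.univ.erase j, q i = 1 - q j := by
      rw [← hq, ← Finset.add_sum_erase _ _ (Finset.mem_univ j)]; ring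
    rw [h3]; ring

/-- Weierstrass' product inequality: the discarded cross terms are nonnegative. This and the next
lemma serve the increasing and the decreasing case of `multiExp_prod_le`. -/
lemma one_add_sum_le_prod_of_nonneg {ι : Type*} (s : Finset ι) (y : ι → ℝ) (h : ∀ i, 0 ≤ y i) :
    1 + ∑ i ∈ s, y i ≤ ∏ i ∈ s, (1 + y i) := by
  classical
  induction s using Finset.induction_on with
  | empty => simp
  | insert a s ha ih =>
    rw [Finset.sum_insert ha, Finset.prod_insert ha]
    have := Finset.sum_nonneg fun i (_ : i ∈ s) => h i
    nlinarith [h a, mul_nonneg (h a) this, mul_le_mul_of_nonneg_left ih (h a)]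

lemma one_add_sum_le_prod_of_nonpos {ι : Type*} (s : Finset ι) (y : ι → ℝ) (h : ∀ i, y i ≤ 0)
    (h' : ∀ i, -1 ≤ y i) : 1 + ∑ i ∈ s, y i ≤ ∏ i ∈ s, (1 + y i) := by
  classical
  induction s using Finset.induction_on with
  | empty => simp
  | insert a s ha ih =>
    rw [Finset.sum_insert ha, Finset.prod_insert ha]
    have h1 : ∏ i ∈ s, (1 + y i) ≤ 1 :=
      Finset.prod_le_one (fun i _ => by linarith [h' i]) fun i _ => by linarith [h i]
    nlinarith [h a, mul_nonneg (neg_nonneg.mpr (h a)) (sub_nonneg.mpr h1)]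

/-- The counts of a multinomial distribution are negatively associated. -/
lemma multiExp_prod_le {m : ℕ} {q : Fin m → ℝ} (hq0 : ∀ i, 0 ≤ q i) (hq : ∑ i, q i = 1) (n : ℕ)
    (f : Fin m → ℕ → ℝ) (hpos : ∀ j r, 0 < f j r)
    (hmono : (∀ j, Monotone (f j)) ∨ ∀ j, Antitone (f j)) :
    multiExp q n (fun c => ∏ j, f j (c j)) ≤ ∏ j, binExp (q j) n (f j) := by
  have hq1 (i) : q i ≤ 1 := hq ▸ Finset.single_le_sum (fun i _ => hq0 i) (Finset.mem_univ i)
  induction n generalizing f with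
  | zero => simp [multiExp, binExp]
  | succ n ih =>
    set A : Fin m → ℝ := fun j => binExp (q j) n (f j) with hA
    set B : Fin m → ℝ := fun j => binExp (q j) n fun r => f j (r + 1) with hB
    have hApos (j) : 0 < A j := binExp_pos (hq0 j) (hq1 j) n (hpos j)
    have hBpos (j) : 0 < B j := binExp_pos (hq0 j) (hq1 j) n fun r => hpos j _
    -- A draw of `i` shifts the argument of `f i` only, and the shifted family is still positive and
    -- monotone, so the induction hypothesis applies to it.
    have hstep (i : Fin m) : multiExp q n (fun c => ∏ j, f j ((c + Pi.single i 1 : Fin m → ℕ) j)) ≤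
        (B i / A i) * ∏ j, A j := by
      have := ih (Function.update f i fun r => f i (r + 1)) ?_ ?_
      · have hl : (fun c : Fin m → ℕ => ∏ j, Function.update f i (fun r => f i (r + 1)) j (c j)) =
            fun c => ∏ j, f j ((c + Pi.single i 1 : Fin m → ℕ) j) := by
          ext c
          refine Finset.prod_congr rfl fun j _ => ?_
          rcases eq_or_ne j i with rfl | h
          · simp
          · simp [h]
        rw [hl] at this
        refine this.trans (le_of_eq ?_)
        rw [← Finset.mul_prod_erase _ _ (Finset.mem_univ i),
          ← Finset.mul_prod_erase _ A (Finset.mem_univ i), ← mul_assoc,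
          div_mul_cancel₀ _ (hApos i).ne']
        congr 1
        · simp [hB]
        · refine Finset.prod_congr rfl fun j hj => ?_
          simp [hA, Finset.ne_of_mem_erase hj]
      · intro j r
        rcases eq_or_ne j i with rfl | h
        · simpa using hpos _ _
        · simpa [h] using hpos _ _
      · refine hmono.imp (fun h j => ?_) fun h j => ?_
        · rcases eq_or_ne j i with rfl | h'
          · rw [Function.update_self]
            exact fun a b hab => h j (Nat.succ_le_succ hab)
          · simpa [h'] using h j
        · rcases eq_or_ne j i with rfl | h'
          · rw [Function.update_self]
            exact fun a b hab => h j (Nat.succ_le_succ hab)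
          · simpa [h'] using h j
    -- Monotonicity gives all ratios `B i / A i` the same side of 1, as the product inequalities
    -- require.
    have hy : 1 + ∑ i, q i * (B i / A i - 1) ≤ ∏ i, (1 + q i * (B i / A i - 1)) := by
      rcases hmono with h | h
      · refine one_add_sum_le_prod_of_nonneg _ _ fun i => mul_nonneg (hq0 i) ?_
        rw [sub_nonneg, one_le_div (hApos i)]
        exact binExp_mono (hq0 i) (hq1 i) n fun r => h i r.le_succ
      · have hle (i) : B i / A i - 1 ≤ 0 := by
          rw [sub_nonpos, div_le_one (hApos i)]
          exact binExp_mono (hq0 i) (hq1 i) n fun r => h i r.le_succ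
        refine one_add_sum_le_prod_of_nonpos _ _
          (fun i => mul_nonpos_of_nonneg_of_nonpos (hq0 i) (hle i)) fun i => ?_
        have := div_pos (hBpos i) (hApos i)
        nlinarith [hq0 i, hq1 i, hle i]
    calc multiExp q (n + 1) (fun c => ∏ j, f j (c j))
        ≤ ∑ i, q i * ((B i / A i) * ∏ j, A j) :=
          Finset.sum_le_sum fun i _ => mul_le_mul_of_nonneg_left (hstep i) (hq0 i)
      _ = (1 + ∑ i, q i * (B i / A i - 1)) * ∏ j, A j := by
          simp_rw [mul_sub, Finset.sum_sub_distrib, mul_one, hq, ← mul_assoc]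
          rw [← Finset.sum_mul]; ring
      _ ≤ (∏ i, (1 + q i * (B i / A i - 1))) * ∏ j, A j :=
          mul_le_mul_of_nonneg_right hy (Finset.prod_nonneg fun j _ => (hApos j).le)
      _ = ∏ j, binExp (q j) (n + 1) (f j) := by
          rw [← Finset.prod_mul_distrib]
          refine Finset.prod_congr rfl fun j _ => ?_
          have := (hApos j).ne'
          rw [binExp]
          change _ = (1 - q j) * A j + q j * B j
          field_simp
          ring

/-! ### Collisions and their moment generating function -/

lemma sum_counts {m : ℕ} (n : ℕ) (ω : ℕ → Fin m) : ∑ j, counts n ω j = n := by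
  have := Finset.card_eq_sum_card_fiberwise (f := ω) (s := Finset.range n) (t := Finset.univ)
    (by simp)
  simpa [counts] using this.symm

lemma K1_eq_sum {m : ℕ} (n : ℕ) (ω : ℕ → Fin m) :
    (K1 n ω : ℝ) = ∑ j, if counts n ω j = 1 then (1 : ℝ) else 0 := by
  simp only [K1, Finset.card_filter, Nat.cast_sum, counts]
  exact Finset.sum_congr rfl fun j _ => by split_ifs <;> simp

/-- The contribution of a symbol with `r` occurrences to the number of colliding samples. -/
def collisionWeight (r : ℕ) : ℕ := if r = 1 then 0 else r

/-- The values are 0, 0, 2, 3, …. The indicator of a count 1 is not monotone; this is why `n - K1`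
replaces `K1`. -/
lemma collisionWeight_mono : Monotone collisionWeight := by
  intro a b h
  unfold collisionWeight
  split_ifs <;> omega

lemma sub_K1_eq_sum {m : ℕ} (n : ℕ) (ω : ℕ → Fin m) :
    (n : ℝ) - K1 n ω = ∑ j, (collisionWeight (counts n ω j) : ℝ) := by
  have h : (n : ℝ) = ∑ j, (counts n ω j : ℝ) := by exact_mod_cast (sum_counts n ω).symm
  rw [K1_eq_sum, h, ← Finset.sum_sub_distrib]
  refine Finset.sum_congr rfl fun j _ => ?_
  unfold collisionWeight
  split_ifs with h
  · simp [h]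
  · simp

lemma sum_toReal {m : ℕ} (p : PMF (Fin m)) : ∑ j, (p j).toReal = 1 := by
  rw [← ENNReal.toReal_sum fun j _ => p.apply_ne_top j, ← tsum_fintype (L := .unconditional _),
    p.tsum_coe, ENNReal.toReal_one]

/-- The integrand is a pure power of exp θ except at `r = 1`, where it is 1; the second term is this
correction. -/
lemma binExp_exp_collisionWeight (x θ : ℝ) (n : ℕ) :
    binExp x n (fun r => Real.exp (θ * collisionWeight r)) =
      (1 + x * (Real.exp θ - 1)) ^ n - n * x * (Real.exp θ - 1) * (1 - x) ^ (n - 1) := by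
  have h : (fun r => Real.exp (θ * collisionWeight r)) = fun r : ℕ =>
      Real.exp θ ^ r + (-(Real.exp θ - 1)) * (if r = 1 then (1 : ℝ) else 0) := by
    ext r
    unfold collisionWeight
    split_ifs with h
    · simp [h]
    · rw [mul_comm, Real.exp_nat_mul]; ring
  rw [h, binExp_add, binExp_const_mul, binExp_pow, binExp_eq_one_indicator]
  ring

/-- A bound for the moment generating function of the number of colliding samples. -/
lemma mgf_collisions_le {m : ℕ} [NeZero m] (p : PMF (Fin m)) (n : ℕ) (θ : ℝ) :
    ProbabilityTheory.mgf (fun ω => (n : ℝ) - K1 n ω) (sampleLaw p) θ ≤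
      ∏ j, ((1 + (p j).toReal * (Real.exp θ - 1)) ^ n -
        n * (p j).toReal * (Real.exp θ - 1) * (1 - (p j).toReal) ^ (n - 1)) := by
  have h : (fun ω : ℕ → Fin m => Real.exp (θ * ((n : ℝ) - K1 n ω))) = fun ω =>
      (fun c : Fin m → ℕ => ∏ j, Real.exp (θ * collisionWeight (c j))) (counts n ω) := by
    ext ω
    rw [sub_K1_eq_sum, Finset.mul_sum, Real.exp_sum]
  rw [ProbabilityTheory.mgf, h, integral_counts p n
    fun c : Fin m → ℕ => ∏ j, Real.exp (θ * collisionWeight (c j))]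
  simp_rw [← binExp_exp_collisionWeight]
  refine multiExp_prod_le (fun _ => ENNReal.toReal_nonneg) (sum_toReal p) n
    (fun _ r => Real.exp (θ * collisionWeight r)) (fun _ _ => Real.exp_pos _) ?_
  rcases le_total 0 θ with hθ | hθ
  · refine Or.inl fun _ a b hab => Real.exp_le_exp.mpr (mul_le_mul_of_nonneg_left ?_ hθ)
    exact_mod_cast collisionWeight_mono hab
  · refine Or.inr fun _ a b hab => Real.exp_le_exp.mpr (mul_le_mul_of_nonpos_left ?_ hθ)
    exact_mod_cast collisionWeight_mono hab

lemma integrable_exp_collisions {m : ℕ} [NeZero m] (p : PMF (Fin m)) (n : ℕ) (θ : ℝ) :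
    Integrable (fun ω => Real.exp (θ * ((n : ℝ) - K1 n ω))) (sampleLaw p) := by
  simp_rw [sub_K1_eq_sum]
  exact integrable_counts n p fun c => Real.exp (θ * ∑ j, (collisionWeight (c j) : ℝ))

lemma unif_toReal {m : ℕ} [NeZero m] (j : Fin m) : (unif m j).toReal = 1 / m := by
  simp [unif]

lemma cu_eq (m : ℕ) [NeZero m] (n : ℕ) : cu m n = n * (1 - 1 / (m : ℝ)) ^ (n - 1) := by
  have hm : (m : ℝ) ≠ 0 := NeZero.ne _
  simp only [cu, K1_eq_sum]
  rw [integral_finsetSum]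
  · have h (j : Fin m) : ∫ ω, (if counts n ω j = 1 then (1 : ℝ) else 0) ∂(sampleLaw (unif m)) =
        n * (1 / m) * (1 - 1 / (m : ℝ)) ^ (n - 1) := by
      rw [integral_counts (unif m) n fun c => if c j = 1 then (1 : ℝ) else 0,
        multiExp_apply (sum_toReal _) n j fun r => if r = 1 then (1 : ℝ) else 0,
        binExp_eq_one_indicator, unif_toReal]
    simp_rw [h]
    simp
    field_simp
  · exact fun j _ => integrable_counts n _ fun c => if c j = 1 then (1 : ℝ) else 0

lemma measurable_K1 {m : ℕ} [NeZero m] (n : ℕ) :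
    Measurable fun ω : ℕ → Fin m => (K1 n ω : ℝ) := by
  simp_rw [K1_eq_sum]
  exact measurable_counts n fun c => ∑ j : Fin m, if c j = 1 then (1 : ℝ) else 0

/-! ### Sizes in a single epoch -/

/-- The sizes for which the large deviation bounds are proved: `n` is the rounded-up sample size of
epoch `k` with logarithmic factor `L`, and it is small in comparison with the large number `m`. -/
structure Regime (m n k : ℕ) (L : ℝ) : Prop where
  one_le_k : 1 ≤ k
  one_le_L : 1 ≤ L
  large : (10 : ℝ) ^ 8 ≤ m
  sparse : (n : ℝ) ≤ m / 500
  lower : k * √(m * L) ≤ n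
  upper : (n : ℝ) ≤ k * √(m * L) + 1

namespace Regime

variable {m n k : ℕ} {L : ℝ}

lemma one_le_cast_k (h : Regime m n k L) : (1 : ℝ) ≤ k := by exact_mod_cast h.one_le_k

lemma main_large (h : Regime m n k L) : (10 : ℝ) ^ 4 ≤ k * √(m * L) := by
  have h1 : (10 : ℝ) ^ 4 ≤ √(m * L) := by
    apply Real.le_sqrt_of_sq_le
    nlinarith [h.large, h.one_le_L]
  nlinarith [h.one_le_cast_k]

lemma main_sq (h : Regime m n k L) : (k * √(m * L)) ^ 2 = k ^ 2 * (m * L) := by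
  rw [mul_pow, Real.sq_sqrt]
  have := h.one_le_L
  positivity

/-- Up to rounding, n is k√(mL), so n²/m is k²L; since k√(mL) ≥ 10⁴, the rounding is absorbed in the
factor 1.01. -/
lemma sq_div_upper (h : Regime m n k L) : (n : ℝ) * (n / m) ≤ 1.01 * (k ^ 2 * L) := by
  have hm : (0 : ℝ) < m := lt_of_lt_of_le (by norm_num) h.large
  rw [← mul_div_assoc, div_le_iff₀ hm]
  have h1 := h.main_large
  have h2 := h.main_sq
  have h3 : (n : ℝ) ≤ 1.001 * (k * √(m * L)) := by linarith [h.upper]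
  have h4 : (0 : ℝ) ≤ n := Nat.cast_nonneg n
  calc (n : ℝ) * n ≤ (1.001 * (k * √(m * L))) * (1.001 * (k * √(m * L))) := by gcongr
    _ = 1.002001 * (k ^ 2 * (m * L)) := by rw [← h2]; ring
    _ ≤ 1.01 * (k ^ 2 * L) * m := by
      have : 0 ≤ (k : ℝ) ^ 2 * (m * L) := by rw [← h2]; positivity
      linarith

lemma sq_div_lower (h : Regime m n k L) : k ^ 2 * L ≤ (n : ℝ) * (n / m) := by
  have hm : (0 : ℝ) < m := lt_of_lt_of_le (by norm_num) h.large
  rw [← mul_div_assoc, le_div_iff₀ hm]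
  have h1 := h.main_large
  calc k ^ 2 * L * m = (k * √(m * L)) * (k * √(m * L)) := by rw [← sq, h.main_sq]; ring
    _ ≤ n * n := mul_self_le_mul_self (by linarith) h.lower

lemma main_mul_sqrt (h : Regime m n k L) : k * √(m * L) * √(L / m) = k * L := by
  have hm : (0 : ℝ) < m := lt_of_lt_of_le (by norm_num) h.large
  have hL := h.one_le_L
  rw [mul_assoc, ← Real.sqrt_mul (by positivity)]
  congr 1
  rw [show m * L * (L / m) = L ^ 2 by field_simp, Real.sqrt_sq (by linarith)]

lemma threshold_lower (h : Regime m n k L) : 7 * (k * L) ≤ 7 * n * √(L / m) := by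
  rw [← h.main_mul_sqrt, ← mul_assoc]
  exact mul_le_mul_of_nonneg_right (mul_le_mul_of_nonneg_left h.lower (by norm_num))
    (Real.sqrt_nonneg _)

lemma threshold_upper (h : Regime m n k L) : 7 * n * √(L / m) ≤ 7.01 * (k * L) := by
  have h1 := h.main_large
  have h3 : (n : ℝ) ≤ 1.001 * (k * √(m * L)) := by linarith [h.upper]
  have h4 : 0 ≤ k * L := mul_nonneg (Nat.cast_nonneg k) (by linarith [h.one_le_L])
  calc 7 * n * √(L / m) ≤ 7 * (1.001 * (k * √(m * L))) * √(L / m) := by gcongr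
    _ = 7.007 * (k * √(m * L) * √(L / m)) := by ring
    _ ≤ 7.01 * (k * L) := by rw [h.main_mul_sqrt]; linarith

lemma large_n (h : Regime m n k L) : (10 : ℝ) ^ 4 ≤ n := h.main_large.trans h.lower

lemma one_le_n (h : Regime m n k L) : 1 ≤ n := by
  have := h.large_n
  have : (1 : ℝ) ≤ n := by linarith
  exact_mod_cast this

/-- The probability that a symbol is missed does not deviate from one by more than `n / m`. -/
lemma pow_lower (h : Regime m n k L) : 1 - (n : ℝ) / m ≤ (1 - 1 / (m : ℝ)) ^ (n - 1) := by
  have hm : (0 : ℝ) < m := lt_of_lt_of_le (by norm_num) h.large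
  have h1 : 1 / (m : ℝ) ≤ 1 := by rw [div_le_one hm]; linarith [h.large]
  have := one_add_mul_le_pow (a := -(1 / (m : ℝ))) (by linarith) (n - 1)
  rw [Nat.cast_sub h.one_le_n] at this
  have h2 : 0 < 1 / (m : ℝ) := by positivity
  calc 1 - (n : ℝ) / m ≤ 1 + ((n : ℝ) - (1 : ℕ)) * -(1 / m) := by
        push_cast; rw [div_eq_mul_one_div]; linarith
    _ ≤ _ := by simpa [sub_eq_add_neg] using this

lemma pow_upper (h : Regime m n k L) : (1 - 1 / (m : ℝ)) ^ (n - 1) ≤ 1 := by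
  have hm : (0 : ℝ) < m := lt_of_lt_of_le (by norm_num) h.large
  have h1 : 1 / (m : ℝ) ≤ 1 := by rw [div_le_one hm]; linarith [h.large]
  have h2 : 0 < 1 / (m : ℝ) := by positivity
  exact pow_le_one₀ (by linarith) (by linarith)

/-! ### False alarms -/

/-- The exponent of the false alarm probability. -/
lemma null_exponent (h : Regime m n k L) {v τ : ℝ} (hv0 : 1 - (n : ℝ) / m ≤ v) (hv1 : v ≤ 1)
    (hτ : 7 * (k * L) ≤ τ) :
    Real.exp (-(1 / (2 * k)) * (n - n * v + τ)) *
      ((1 + 1 / (m : ℝ) * (Real.exp (1 / (2 * k)) - 1)) ^ n -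
        n * (1 / (m : ℝ)) * (Real.exp (1 / (2 * k)) - 1) * v) ^ m ≤ Real.exp (-(2 * L)) := by
  have hm : (0 : ℝ) < m := lt_of_lt_of_le (by norm_num) h.large
  have hk := h.one_le_cast_k
  have hL := h.one_le_L
  have hk0 : (0 : ℝ) < k := by linarith
  -- This tilt gains θτ ≥ 3.5L, linear in θ, against costs of order θ²n²/m, about L/4.
  set θ : ℝ := 1 / (2 * k) with hθ
  have hθ0 : 0 < θ := by positivity
  have hθ1 : θ ≤ 1 / 2 := by
    rw [hθ, div_le_div_iff₀ (by positivity) (by norm_num)]; linarith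
  set S : ℝ := Real.exp θ - 1 with hS
  have hS0 : θ ≤ S := by rw [hS]; linarith [Real.add_one_le_exp θ]
  have hS1 : S - θ ≤ θ ^ 2 := by
    have := Real.abs_exp_sub_one_sub_id_le (x := θ) (by rw [abs_of_pos hθ0]; linarith)
    exact (le_abs_self _).trans this
  have hS2 : S ≤ 3 / 2 * θ := by nlinarith
  set r : ℝ := (n : ℝ) / m with hr
  have hr0 : 0 ≤ r := by positivity
  have hr1 : r ≤ 1 / 500 := by
    rw [hr, div_le_div_iff₀ hm (by norm_num)]; linarith [h.sparse]
  have hn0 : (0 : ℝ) ≤ n := Nat.cast_nonneg n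
  have hrS0 : 0 ≤ r * S := mul_nonneg hr0 (by linarith)
  have hrS : r * S ≤ 1 := by nlinarith
  have hpow : (1 + 1 / (m : ℝ) * S) ^ n ≤ 1 + r * S + (r * S) ^ 2 := by
    calc (1 + 1 / (m : ℝ) * S) ^ n ≤ (Real.exp (1 / (m : ℝ) * S)) ^ n := by
          have : 0 ≤ 1 / (m : ℝ) * S := mul_nonneg (by positivity) (by linarith)
          gcongr
          linarith [Real.add_one_le_exp (1 / (m : ℝ) * S)]
      _ = Real.exp (r * S) := by rw [← Real.exp_nat_mul]; congr 1; rw [hr]; ring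
      _ ≤ _ := by
          have := Real.abs_exp_sub_one_sub_id_le (x := r * S) (by rwa [abs_of_nonneg hrS0])
          linarith [le_abs_self (Real.exp (r * S) - 1 - r * S)]
  have hpow' : 1 + r * S ≤ (1 + 1 / (m : ℝ) * S) ^ n := by
    have := one_add_mul_le_pow (a := 1 / (m : ℝ) * S)
      (by have : 0 ≤ 1 / (m : ℝ) * S := mul_nonneg (by positivity) (by linarith)
          linarith) n
    calc 1 + r * S = 1 + n * (1 / (m : ℝ) * S) := by rw [hr]; ring
      _ ≤ _ := this
  have hnr : n * (1 / (m : ℝ)) * S * v = r * S * v := by rw [hr]; ring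
  rw [hnr]
  set P : ℝ := (1 + 1 / (m : ℝ) * S) ^ n with hP
  have hrSv : r * S * v ≤ r * S := by nlinarith
  have hB : (P - r * S * v) ^ m ≤ Real.exp (m * (r * S + (r * S) ^ 2 - r * S * v)) := by
    rw [Real.exp_nat_mul]
    gcongr
    · linarith
    · linarith [Real.add_one_le_exp (r * S + (r * S) ^ 2 - r * S * v)]
  refine (mul_le_mul_of_nonneg_left hB (Real.exp_pos _).le).trans ?_
  rw [← Real.exp_add]
  apply Real.exp_le_exp.mpr
  have hmr : m * r = n := by rw [hr]; field_simp
  have e1 : m * (r * S + (r * S) ^ 2 - r * S * v) = S * (n * (1 - v)) + n * r * S ^ 2 := by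
    calc m * (r * S + (r * S) ^ 2 - r * S * v)
        = (m * r) * (S * (1 - v)) + (m * r) * r * S ^ 2 := by ring
      _ = _ := by rw [hmr]; ring
  have hnv : n * (1 - v) ≤ n * r := mul_le_mul_of_nonneg_left (by linarith) hn0
  have hnv0 : 0 ≤ n * (1 - v) := mul_nonneg hn0 (by linarith)
  have h1 : (S - θ) * (n * (1 - v)) ≤ θ ^ 2 * (n * r) := by
    calc (S - θ) * (n * (1 - v)) ≤ θ ^ 2 * (n * (1 - v)) := by gcongr
      _ ≤ _ := by gcongr
  have h2 : n * r * S ^ 2 ≤ n * r * (9 / 4 * θ ^ 2) := by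
    have : S ^ 2 ≤ 9 / 4 * θ ^ 2 := by nlinarith
    gcongr
  have h3 : θ ^ 2 * (n * r) ≤ 0.26 * L := by
    calc θ ^ 2 * (n * r) ≤ θ ^ 2 * (1.01 * (k ^ 2 * L)) := by
          exact mul_le_mul_of_nonneg_left h.sq_div_upper (sq_nonneg θ)
      _ = 1.01 / 4 * L := by rw [hθ]; field_simp; norm_num
      _ ≤ _ := by linarith
  have h4 : 3.5 * L ≤ θ * τ := by
    calc 3.5 * L = θ * (7 * (k * L)) := by rw [hθ]; field_simp; norm_num
      _ ≤ _ := by gcongr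
  -- The exponent is at most (0.26 + 9/4 · 0.26 - 3.5)L, which is below -2L.
  rw [e1]
  nlinarith

end Regime

/-- The false alarm probability of a single epoch. -/
lemma false_alarm_le {m : ℕ} [NeZero m] {n k : ℕ} {L : ℝ} (h : Regime m n k L) :
    (sampleLaw (unif m)).real {ω | cu m n - (K1 n ω : ℝ) > 7 * n * √(L / m)} ≤
      Real.exp (-(2 * L)) := by
  have hk := h.one_le_cast_k
  have hsub : {ω : ℕ → Fin m | cu m n - (K1 n ω : ℝ) > 7 * n * √(L / m)} ⊆
      {ω | n - cu m n + 7 * n * √(L / m) ≤ (n : ℝ) - K1 n ω} := by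
    intro ω hω
    simp only [Set.mem_ofPred_eq] at hω ⊢
    linarith
  refine (measureReal_mono hsub).trans ?_
  refine (ProbabilityTheory.measure_ge_le_exp_mul_mgf _ (t := 1 / (2 * k)) (by positivity)
    (integrable_exp_collisions (unif m) n _)).trans ?_
  refine (mul_le_mul_of_nonneg_left (mgf_collisions_le _ _ _) (Real.exp_pos _).le).trans ?_
  simp only [unif_toReal, Finset.prod_const, Finset.card_univ, Fintype.card_fin, cu_eq]
  exact h.null_exponent h.pow_lower h.pow_upper h.threshold_lower

/-! ### Missed detections -/

/-- A bound for the moment generating function of the collisions of one symbol. -/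
lemma one_sub_pow_add_le {n : ℕ} (hn : 3 ≤ n) {x s : ℝ} (hx0 : 0 ≤ x) (hx1 : x ≤ 1) (hs0 : 0 ≤ s)
    (hs1 : s ≤ 1 / 2) :
    (1 - x * s) ^ n + n * x * s * (1 - x) ^ (n - 1) ≤
      Real.exp (-(s * (n * (x * (1 - Real.exp (-((1 - s) * (n - 3) * x))))))) := by
  have hxs : 0 ≤ x * s := mul_nonneg hx0 hs0
  have hxs1 : x * s ≤ x / 2 := by nlinarith
  have hb : 0 ≤ 1 - x * s := by linarith
  have h1 : 1 - x ≤ (1 - x * s) * Real.exp (-((1 - s) * x)) := by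
    calc 1 - x ≤ (1 - x * s) * (1 - (1 - s) * x) := by
          nlinarith [mul_nonneg (mul_nonneg hxs hx0) (by linarith : 0 ≤ 1 - s)]
      _ ≤ _ := mul_le_mul_of_nonneg_left (Real.one_sub_le_exp_neg _) hb
  -- Two of the n - 1 exponential factors pay for the missing n-th factor 1 - xs; this leaves n - 3.
  have h2 : Real.exp (-((1 - s) * x)) ^ 2 ≤ 1 - x * s := by
    rw [← Real.exp_nat_mul]
    have hle : ((2 : ℕ) : ℝ) * -((1 - s) * x) ≤ -x := by push_cast; nlinarith
    have hinv : Real.exp (-x) ≤ 1 - x / 2 := by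
      rw [Real.exp_neg, inv_le_iff_one_le_mul₀ (Real.exp_pos x)]
      have := Real.add_one_le_exp x
      nlinarith
    linarith [Real.exp_le_exp.mpr hle]
  have h3 : (1 - x) ^ (n - 1) ≤ (1 - x * s) ^ n * Real.exp (-((1 - s) * (n - 3) * x)) := by
    obtain ⟨l, rfl⟩ := Nat.exists_eq_add_of_le hn
    have e : Real.exp (-((1 - s) * (((3 + l : ℕ) : ℝ) - 3) * x)) = Real.exp (-((1 - s) * x)) ^ l := by
      rw [← Real.exp_nat_mul]; congr 1; push_cast; ring
    rw [e]
    calc (1 - x) ^ (3 + l - 1) ≤ ((1 - x * s) * Real.exp (-((1 - s) * x))) ^ (3 + l - 1) := by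
          gcongr
      _ = (1 - x * s) ^ (2 + l) * Real.exp (-((1 - s) * x)) ^ l *
          Real.exp (-((1 - s) * x)) ^ 2 := by
          rw [show 3 + l - 1 = 2 + l by omega, mul_pow]; ring
      _ ≤ (1 - x * s) ^ (2 + l) * Real.exp (-((1 - s) * x)) ^ l * (1 - x * s) := by gcongr
      _ = _ := by ring
  set E := Real.exp (-((1 - s) * (n - 3) * x)) with hE
  have hnxs : 0 ≤ n * x * s := by positivity
  calc (1 - x * s) ^ n + n * x * s * (1 - x) ^ (n - 1)
      ≤ (1 - x * s) ^ n + n * x * s * ((1 - x * s) ^ n * E) := by gcongr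
    _ = (1 - x * s) ^ n * (n * x * s * E + 1) := by ring
    _ ≤ Real.exp (-(x * s)) ^ n * Real.exp (n * x * s * E) := by
        gcongr
        · exact Real.one_sub_le_exp_neg _
        · exact Real.add_one_le_exp _
    _ = _ := by
        rw [← Real.exp_nat_mul, ← Real.exp_add]; congr 1; ring

/-- The pointwise convexity estimate behind the separation of the expected collision numbers. -/
lemma shifted_mul_one_sub_exp_ge {b t : ℝ} (hb0 : 0 ≤ b) (hb1 : b ≤ 1) (ht : -b ≤ t) :
    b * t + (1 - 2 * b) * (t ^ 2 / (1 + |t|)) ≤ (b + t) * (1 - Real.exp (-t)) := by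
  rcases le_total 0 t with h | h
  · rw [abs_of_nonneg h]
    have h1 : t / (1 + t) ≤ 1 - Real.exp (-t) := by
      have h2 : Real.exp (-t) ≤ 1 / (1 + t) := by
        rw [Real.exp_neg, ← one_div]
        exact one_div_le_one_div_of_le (by linarith) (by linarith [Real.add_one_le_exp t])
      have : t / (1 + t) = 1 - 1 / (1 + t) := by field_simp; ring
      linarith
    calc b * t + (1 - 2 * b) * (t ^ 2 / (1 + t))
        = (b + t) * (t / (1 + t)) - b * (t ^ 2 / (1 + t)) := by field_simp; ring
      _ ≤ (b + t) * (t / (1 + t)) := by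
          have : 0 ≤ b * (t ^ 2 / (1 + t)) := by positivity
          linarith
      _ ≤ _ := mul_le_mul_of_nonneg_left h1 (by linarith)
  · rw [abs_of_nonpos h]
    set y := -t with hy
    have hy0 : 0 ≤ y := by linarith
    have hyb : y ≤ b := by linarith
    have hty : t = -y := by linarith
    rw [hty]
    have h1 := Real.add_one_le_exp y
    have h2 : Real.exp y - 1 - y ≤ y ^ 2 :=
      (le_abs_self _).trans (Real.abs_exp_sub_one_sub_id_le (by rw [abs_of_nonneg hy0]; linarith))
    -- Since y ≤ 1, the term 2b · y²/(1 + y) absorbs the error by² of replacing exp y - 1 by y.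
    have h3 : y ^ 2 / 2 ≤ y ^ 2 / (1 + y) :=
      div_le_div_of_nonneg_left (sq_nonneg y) (by linarith) (by linarith)
    have h4 : y ^ 2 / (1 + y) ≤ y ^ 2 := div_le_self (sq_nonneg y) (by linarith)
    have h5 : b * (Real.exp y - 1 - y) ≤ b * y ^ 2 := mul_le_mul_of_nonneg_left h2 hb0
    have h6 : y * y ≤ y * (Real.exp y - 1) := mul_le_mul_of_nonneg_left (by linarith) hy0
    have h7 := mul_le_mul_of_nonneg_left h3 hb0
    have h8 : (-y) ^ 2 = y ^ 2 := by ring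
    rw [h8]
    nlinarith

/-- A lower bound for the excess of collisions of a distribution at distance `g` from uniform. -/
lemma sum_mul_one_sub_exp_ge {m : ℕ} (hm : 0 < m) {q : Fin m → ℝ} (hq0 : ∀ j, 0 ≤ q j)
    (hq : ∑ j, q j = 1) {β : ℝ} (hβ0 : 0 ≤ β) (hβ : β ≤ m / 500) :
    1 - Real.exp (-(β / m)) + 0.95 * (β * (∑ j, |q j - 1 / m|) ^ 2 / m) ≤
      ∑ j, q j * (1 - Real.exp (-(β * q j))) := by
  rcases hβ0.eq_or_lt with rfl | hβpos
  · simp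
  have hm' : (0 : ℝ) < m := by exact_mod_cast hm
  set b : ℝ := β / m with hb
  have hb0 : 0 ≤ b := by positivity
  have hb1 : b ≤ 1 / 500 := by rw [hb, div_le_div_iff₀ hm' (by norm_num)]; linarith
  set d : Fin m → ℝ := fun j => q j - 1 / m with hd
  have hdsum : ∑ j, d j = 0 := by
    simp only [hd, Finset.sum_sub_distrib, hq]; simp; field_simp; ring
  set g : ℝ := ∑ j, |q j - 1 / m| with hg
  have hg0 : 0 ≤ g := Finset.sum_nonneg fun j _ => abs_nonneg _
  have hg2 : g ≤ 2 := by
    calc g ≤ ∑ j : Fin m, (q j + 1 / (m : ℝ)) := Finset.sum_le_sum fun j _ => by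
          have : 0 ≤ 1 / (m : ℝ) := by positivity
          exact abs_le.mpr ⟨by linarith [hq0 j], by linarith [hq0 j]⟩
      _ = 2 := by rw [Finset.sum_add_distrib, hq]; simp; field_simp; norm_num
  set T : ℝ := ∑ j, (β * d j) ^ 2 / (1 + |β * d j|) with hT
  -- Cauchy–Schwarz in Sedrakyan's form; the denominators sum to m + βg.
  have hTge : β ^ 2 * g ^ 2 / (m + β * g) ≤ T := by
    have := Finset.sq_sum_div_le_sum_sq_div (Finset.univ : Finset (Fin m))
      (fun j => |β * d j|) (g := fun j => 1 + |β * d j|) fun j _ => by positivity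
    have e1 : ∑ j, |β * d j| = β * g := by
      simp only [abs_mul, abs_of_nonneg hβ0, ← Finset.mul_sum, hg, hd]
    rw [Finset.sum_add_distrib, e1] at this
    simp only [sq_abs, Finset.sum_const, Finset.card_univ, Fintype.card_fin, nsmul_eq_mul,
      mul_one] at this
    rwa [← mul_pow]
  -- The pointwise estimate is summed with t = βd_j and b + t = βq_j; its linear terms cancel
  -- because the deviations d_j sum to zero.
  have hsum : (1 - 2 * b) * T ≤ β * ∑ j, q j * (1 - Real.exp (-(β * d j))) := by
    have h1 (j) : b * (β * d j) + (1 - 2 * b) * ((β * d j) ^ 2 / (1 + |β * d j|)) ≤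
        β * (q j * (1 - Real.exp (-(β * d j)))) := by
      have := shifted_mul_one_sub_exp_ge (b := b) (t := β * d j) hb0 (by linarith) (by
        have : β * d j = β * q j - b := by simp only [hd, hb]; ring
        rw [this]
        linarith [mul_nonneg hβ0 (hq0 j)])
      refine this.trans (le_of_eq ?_)
      have : b + β * d j = β * q j := by simp only [hd, hb]; ring
      rw [this]; ring
    have := Finset.sum_le_sum fun j (_ : j ∈ Finset.univ) => h1 j
    rw [Finset.sum_add_distrib, ← Finset.mul_sum, ← Finset.mul_sum, ← Finset.mul_sum,
      ← Finset.mul_sum, hdsum] at this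
    linarith
  have hdecomp : ∑ j, q j * (1 - Real.exp (-(β * q j))) =
      1 - Real.exp (-b) + Real.exp (-b) * ∑ j, q j * (1 - Real.exp (-(β * d j))) := by
    have h1 (j) : q j * (1 - Real.exp (-(β * q j))) = q j * (1 - Real.exp (-b)) +
        Real.exp (-b) * (q j * (1 - Real.exp (-(β * d j)))) := by
      have : -(β * q j) = -b + -(β * d j) := by simp only [hd, hb]; ring
      rw [this, Real.exp_add]; ring
    simp_rw [h1]
    rw [Finset.sum_add_distrib, ← Finset.sum_mul, hq, ← Finset.mul_sum]; ring
  rw [hdecomp]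
  have hexp : 0.99 ≤ Real.exp (-b) := by linarith [Real.one_sub_le_exp_neg b]
  set U : ℝ := ∑ j, q j * (1 - Real.exp (-(β * d j))) with hU
  have hV0 : 0 ≤ β * g ^ 2 / m := by positivity
  have hT2 : 0.99 * (β * (β * g ^ 2 / m)) ≤ T := by
    refine le_trans ?_ hTge
    rw [le_div_iff₀ (by positivity)]
    have e : 0.99 * (β * (β * g ^ 2 / m)) * (m + β * g) = β ^ 2 * g ^ 2 * (0.99 * (1 + b * g)) := by
      rw [hb]; field_simp
    rw [e]
    have : 0.99 * (1 + b * g) ≤ 1 := by nlinarith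
    calc β ^ 2 * g ^ 2 * (0.99 * (1 + b * g)) ≤ β ^ 2 * g ^ 2 * 1 := by gcongr
      _ = _ := mul_one _
  have hU1 : 0.98 * (β * g ^ 2 / m) ≤ U := by
    have h1 : 0.99 * (0.99 * (β * (β * g ^ 2 / m))) ≤ β * U := by
      refine le_trans ?_ hsum
      have h0 : 0 ≤ 0.99 * (β * (β * g ^ 2 / m)) := by positivity
      calc _ ≤ (1 - 2 * b) * (0.99 * (β * (β * g ^ 2 / m))) :=
            mul_le_mul_of_nonneg_right (by linarith) h0
        _ ≤ _ := mul_le_mul_of_nonneg_left hT2 (by linarith)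
    have h2 : β * (0.98 * (β * g ^ 2 / m)) ≤ β * U := by
      have : 0 ≤ β * (β * g ^ 2 / m) := by positivity
      linarith
    exact le_of_mul_le_mul_left h2 hβpos
  have hU0 : 0 ≤ U := le_trans (by positivity) hU1
  nlinarith

namespace Regime

variable {m n k : ℕ} {L : ℝ}

/-- The expected collision number of uniform samples, in comparison with its Poisson value. -/
lemma exp_sub_pow_le (h : Regime m n k L) {s : ℝ} (hs0 : 0 ≤ s)
    (hs1 : s ≤ 1) :
    n * (Real.exp (-((1 - s) * (n - 3) / m)) - (1 - 1 / (m : ℝ)) ^ (n - 1)) ≤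
      (3 + s * n) * (n / m) := by
  have hm : (0 : ℝ) < m := lt_of_lt_of_le (by norm_num) h.large
  have hm1 : (0 : ℝ) < m - 1 := by linarith [h.large]
  have hn0 : (0 : ℝ) ≤ n := Nat.cast_nonneg n
  have hn1 : (1 : ℝ) ≤ n := by exact_mod_cast h.one_le_n
  have h1 : Real.exp (-(1 / (m - 1 : ℝ))) ≤ 1 - 1 / (m : ℝ) := by
    rw [Real.exp_neg]
    have e : 1 - 1 / (m : ℝ) = (1 + 1 / (m - 1 : ℝ))⁻¹ := by field_simp; ring
    rw [e]
    refine inv_anti₀ (by positivity) ?_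
    linarith [Real.add_one_le_exp (1 / (m - 1 : ℝ))]
  -- (n - 1)/(m - 1) ≤ n/m because n ≤ m.
  have h2 : Real.exp (-((n : ℝ) / m)) ≤ (1 - 1 / (m : ℝ)) ^ (n - 1) := by
    calc Real.exp (-((n : ℝ) / m)) ≤ Real.exp (-((n - 1 : ℝ) / (m - 1))) := by
          apply Real.exp_le_exp.mpr
          rw [neg_le_neg_iff, div_le_div_iff₀ hm1 hm]
          linarith [h.sparse]
      _ = Real.exp (-(1 / (m - 1 : ℝ))) ^ (n - 1) := by
          rw [← Real.exp_nat_mul, Nat.cast_sub h.one_le_n]; congr 1; push_cast; ring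
      _ ≤ _ := by gcongr
  set b := (1 - s) * (n - 3) / (m : ℝ) with hb
  have h3 : Real.exp (-b) - Real.exp (-((n : ℝ) / m)) ≤ (3 + s * n) / m := by
    have e : (n : ℝ) / m - b ≤ (3 + s * n) / m := by
      rw [hb, ← sub_div]
      gcongr
      nlinarith
    rcases le_total ((n : ℝ) / m) b with h' | h'
    · have := Real.exp_le_exp.mpr (neg_le_neg h')
      have : 0 ≤ (3 + s * n) / (m : ℝ) := by positivity
      linarith
    · refine le_trans ?_ e
      have hb0 : -b ≤ 0 := by
        have h10 := h.large_n
        exact neg_nonpos.mpr (div_nonneg (mul_nonneg (by linarith) (by linarith)) hm.le)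
      have h4 := Real.one_sub_le_exp_neg ((n : ℝ) / m - b)
      have h5 : Real.exp (-((n : ℝ) / m)) = Real.exp (-b) * Real.exp (-((n : ℝ) / m - b)) := by
        rw [← Real.exp_add]; congr 1; ring
      have h6 : Real.exp (-b) ≤ 1 := Real.exp_le_one_iff.mpr hb0
      have h7 := Real.exp_pos (-b)
      rw [h5]
      nlinarith
  calc n * (Real.exp (-b) - (1 - 1 / (m : ℝ)) ^ (n - 1)) ≤ n * ((3 + s * n) / m) := by
        gcongr; linarith
    _ = _ := by ring

/-- The exponent of the missed detection probability. -/
lemma alt_exponent (h : Regime m n k L) {g τ G s : ℝ} (hk2 : 28 ≤ 2 * (k : ℝ))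
    (hs : s = 1 - Real.exp (-(1 / (k : ℝ)))) (hkg : 56 ≤ k * g ^ 2)
    (hτ : τ ≤ 7.01 * (k * L))
    (hG : 1 - Real.exp (-((1 - s) * (n - 3) / m)) +
      0.95 * ((1 - s) * (n - 3) * g ^ 2 / m) ≤ G) :
    1 / k * (n - n * (1 - 1 / (m : ℝ)) ^ (n - 1) + τ) - s * (n * G) ≤ -(4 * L) := by
  have hm : (0 : ℝ) < m := lt_of_lt_of_le (by norm_num) h.large
  have hL := h.one_le_L
  have hk0 : (0 : ℝ) < k := by linarith
  set θ : ℝ := 1 / k with hθ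
  have hθ0 : 0 < θ := by positivity
  have hθ1 : θ ≤ 1 / 14 := by
    rw [hθ, div_le_div_iff₀ hk0 (by norm_num)]; linarith
  have hkθ : k * θ = 1 := by rw [hθ]; field_simp
  have hs1 : s ≤ θ := by linarith [Real.one_sub_le_exp_neg θ]
  have hs2 : θ - s ≤ θ ^ 2 := by
    have := Real.abs_exp_sub_one_sub_id_le (x := -θ) (by rw [abs_neg, abs_of_pos hθ0]; linarith)
    have := (le_abs_self _).trans this
    rw [neg_sq] at this
    linarith
  have hs3 : 13 / 14 * θ ≤ s := by nlinarith
  have hs0 : 0 < s := by nlinarith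
  set v := (1 - 1 / (m : ℝ)) ^ (n - 1) with hv
  set E := Real.exp (-((1 - s) * (n - 3) / m)) with hE
  set r : ℝ := (n : ℝ) / m with hr
  have hr0 : 0 ≤ r := by positivity
  have hr1 : r ≤ 1 / 500 := by
    rw [hr, div_le_div_iff₀ hm (by norm_num)]; linarith [h.sparse]
  have hn0 : (0 : ℝ) ≤ n := Nat.cast_nonneg n
  have hn4 := h.large_n
  have hpois : n * (E - v) ≤ (3 + s * n) * r := h.exp_sub_pow_le hs0.le (by linarith)
  have hnv : n * (1 - v) ≤ n * r := mul_le_mul_of_nonneg_left (by linarith [h.pow_lower]) hn0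
  have hup : θ ^ 2 * (n * r) ≤ 1.01 * L := by
    calc θ ^ 2 * (n * r) ≤ θ ^ 2 * (1.01 * (k ^ 2 * L)) :=
          mul_le_mul_of_nonneg_left h.sq_div_upper (sq_nonneg θ)
      _ = 1.01 * L * (k * θ) ^ 2 := by ring
      _ = _ := by rw [hkθ]; ring
  have h1 : (θ - s) * (n * (1 - v)) ≤ 1.01 * L := by
    calc (θ - s) * (n * (1 - v)) ≤ (θ - s) * (n * r) :=
          mul_le_mul_of_nonneg_left hnv (by linarith)
      _ ≤ θ ^ 2 * (n * r) := mul_le_mul_of_nonneg_right hs2 (mul_nonneg hn0 hr0)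
      _ ≤ _ := hup
  have h2 : s * (n * (E - v)) ≤ 2 * L := by
    calc s * (n * (E - v)) ≤ s * ((3 + s * n) * r) := mul_le_mul_of_nonneg_left hpois hs0.le
      _ = 3 * s * r + s ^ 2 * (n * r) := by ring
      _ ≤ 3 * s * r + θ ^ 2 * (n * r) := by gcongr
      _ ≤ 2 * L := by nlinarith
  have h3 : θ * τ ≤ 7.01 * L := by
    calc θ * τ ≤ θ * (7.01 * (k * L)) := mul_le_mul_of_nonneg_left hτ hθ0.le
      _ = 7.01 * L * (k * θ) := by ring
      _ = _ := by rw [hkθ]; ring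
  -- The gain from the distance: s is about 1/k, so it is of order kγ²L with kγ² ≥ 56.
  have h4 : 0.7 * (56 * L) ≤ s * (n * (0.95 * ((1 - s) * (n - 3) * g ^ 2 / m))) := by
    have a1 : 0.9 * (n : ℝ) ≤ (1 - s) * (n - 3) := by nlinarith
    have hg2 : 0 ≤ g ^ 2 := sq_nonneg g
    calc 0.7 * (56 * L) ≤ 0.7 * (k * g ^ 2 * L) := by gcongr
      _ = θ * (0.7 * (k ^ 2 * L) * g ^ 2) := by
          calc 0.7 * (k * g ^ 2 * L) = 0.7 * (k * g ^ 2 * L) * (k * θ) := by rw [hkθ, mul_one]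
            _ = _ := by ring
      _ ≤ θ * (0.7 * (n * r) * g ^ 2) := by
          have := h.sq_div_lower
          gcongr
      _ ≤ (14 / 13 * s) * (0.7 * (n * r) * g ^ 2) := by
          gcongr; linarith
      _ ≤ s * (n * (0.95 * (0.9 * n * g ^ 2 / m))) := by
          have e : s * (n * (0.95 * (0.9 * n * g ^ 2 / m))) = 0.855 * (s * (n * r) * g ^ 2) := by
            rw [hr]; ring
          have : 0 ≤ s * (n * r) * g ^ 2 := by positivity
          rw [e]; linarith
      _ ≤ _ := by gcongr
  have h5 : s * (n * (1 - E + 0.95 * ((1 - s) * (n - 3) * g ^ 2 / m))) ≤ s * (n * G) := by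
    gcongr
  -- The exponent is at most (1.01 + 2 + 7.01 - 39.2)L, well below -4L.
  linarith

end Regime

/-- The missed detection probability of a single late epoch. -/
lemma missed_detection_le {m : ℕ} [NeZero m] {n k : ℕ} {L : ℝ} (h : Regime m n k L)
    (p : PMF (Fin m)) (hk : 14 ≤ k) (hkg : 56 ≤ k * distUnif p ^ 2) :
    (sampleLaw p).real {ω | ¬ cu m n - (K1 n ω : ℝ) > 7 * n * √(L / m)} ≤
      Real.exp (-(4 * L)) := by
  have hk' : (14 : ℝ) ≤ k := by exact_mod_cast hk
  have hk0 : (0 : ℝ) < k := by linarith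
  have hm : (0 : ℝ) < m := lt_of_lt_of_le (by norm_num) h.large
  have hn4 := h.large_n
  have hsub : {ω : ℕ → Fin m | ¬ cu m n - (K1 n ω : ℝ) > 7 * n * √(L / m)} ⊆
      {ω | (n : ℝ) - K1 n ω ≤ n - cu m n + 7 * n * √(L / m)} := by
    intro ω hω
    simp only [Set.mem_ofPred_eq, not_lt] at hω ⊢
    linarith
  refine (measureReal_mono hsub).trans ?_
  refine (ProbabilityTheory.measure_le_le_exp_mul_mgf _ (t := -(1 / k))
    (neg_nonpos.mpr (by positivity)) (integrable_exp_collisions p n _)).trans ?_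
  refine (mul_le_mul_of_nonneg_left (mgf_collisions_le _ _ _) (Real.exp_pos _).le).trans ?_
  set s : ℝ := 1 - Real.exp (-(1 / (k : ℝ))) with hs
  have hs0 : 0 ≤ s := by
    have : Real.exp (-(1 / (k : ℝ))) ≤ 1 :=
      Real.exp_le_one_iff.mpr (neg_nonpos.mpr (by positivity))
    linarith
  have hs1 : s ≤ 1 / 14 := by
    have h1 := Real.one_sub_le_exp_neg (1 / (k : ℝ))
    have h2 : 1 / (k : ℝ) ≤ 1 / 14 := by
      rw [div_le_div_iff₀ hk0 (by norm_num)]; linarith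
    linarith
  set q : Fin m → ℝ := fun j => (p j).toReal with hq
  have hq0 (j) : 0 ≤ q j := ENNReal.toReal_nonneg
  have hqs : ∑ j, q j = 1 := sum_toReal p
  have hq1 (j) : q j ≤ 1 := hqs ▸ Finset.single_le_sum (fun i _ => hq0 i) (Finset.mem_univ j)
  have hn3 : 3 ≤ n := by
    have : (3 : ℝ) ≤ n := by linarith
    exact_mod_cast this
  set β : ℝ := (1 - s) * (n - 3) with hβ
  set G : ℝ := ∑ j, q j * (1 - Real.exp (-(β * q j))) with hG
  have hprod : ∏ j, ((1 + q j * (Real.exp (-(1 / (k : ℝ))) - 1)) ^ n -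
      n * q j * (Real.exp (-(1 / (k : ℝ))) - 1) * (1 - q j) ^ (n - 1)) ≤
      Real.exp (-(s * (n * G))) := by
    have e : -(s * (n * G)) = ∑ j, -(s * (n * (q j * (1 - Real.exp (-(β * q j)))))) := by
      rw [Finset.sum_neg_distrib, ← Finset.mul_sum, ← Finset.mul_sum]
    rw [e, Real.exp_sum]
    refine Finset.prod_le_prod (fun j _ => ?_) fun j _ => ?_
    · rw [← binExp_exp_collisionWeight]
      exact (binExp_pos (hq0 j) (hq1 j) n fun r => Real.exp_pos _).le
    · refine le_trans (le_of_eq ?_) (one_sub_pow_add_le hn3 (hq0 j) (hq1 j) hs0 (by linarith))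
      rw [hs]; ring
  refine (mul_le_mul_of_nonneg_left hprod (Real.exp_pos _).le).trans ?_
  rw [← Real.exp_add]
  apply Real.exp_le_exp.mpr
  have hGge := sum_mul_one_sub_exp_ge (NeZero.pos m) hq0 hqs (β := β)
    (mul_nonneg (by linarith) (by linarith)) (by rw [hβ]; nlinarith [h.sparse])
  have := h.alt_exponent (g := distUnif p) (by linarith) hs hkg h.threshold_upper hGge
  rw [cu_eq]
  linarith

/-! ### Consequences of the conditions on m, ε and δ -/

lemma m0_spec {ε δ : ℝ} (hε : 0 < ε) (hδ : 0 < δ) :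
    1123 * Real.exp (-(1 / 4) * √(m0 ε δ : ℝ)) ≤ δ * ε ^ 2 := by
  -- Nonemptiness matters: the infimum of the empty set would be the default 0.
  have hne : {l : ℕ | 0 < l ∧
      1123 * (l : ℝ) ^ (1 / 4 : ℝ) * Real.exp (-(1 / 4) * √(l : ℝ)) ≤ δ * ε ^ 2}.Nonempty := by
    have h1 := (tendsto_rpow_mul_exp_neg_mul_atTop_nhds_zero (1 / 2) (1 / 4) (by norm_num)).comp
      (Real.tendsto_sqrt_atTop.comp tendsto_natCast_atTop_atTop)
    have h2 := h1.const_mul (1123 : ℝ)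
    rw [mul_zero] at h2
    have h3 : 0 < δ * ε ^ 2 := by positivity
    obtain ⟨l, hl, hl0⟩ := ((h2.eventually (eventually_le_nhds h3)).and
      (Filter.eventually_gt_atTop 0)).exists
    refine ⟨l, hl0, ?_⟩
    have e : (√(l : ℝ)) ^ (1 / 2 : ℝ) = (l : ℝ) ^ (1 / 4 : ℝ) := by
      rw [Real.sqrt_eq_rpow, ← Real.rpow_mul (Nat.cast_nonneg l)]; norm_num
    simp only [Function.comp_apply, e] at hl
    linarith
  have hmem := Nat.sInf_mem hne
  change m0 ε δ ∈ _ at hmem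
  obtain ⟨hpos, hle⟩ := hmem
  refine le_trans ?_ hle
  have h1 : (1 : ℝ) ≤ (m0 ε δ : ℝ) ^ (1 / 4 : ℝ) :=
    Real.one_le_rpow (by exact_mod_cast hpos) (by norm_num)
  have := Real.exp_pos (-(1 / 4) * √(m0 ε δ : ℝ))
  nlinarith

/-- The logarithmic factor in the sample size of an epoch. -/
abbrev logFactor (δ : ℝ) (k : ℕ) : ℝ := Real.log ((k : ℝ) + 2 / δ)

lemma two_le_two_div {δ : ℝ} (hδ : 0 < δ) (hδ1 : δ < 1) : 2 ≤ 2 / δ := by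
  rw [le_div_iff₀ hδ]; linarith

lemma one_le_logFactor {δ : ℝ} (hδ : 0 < δ) (hδ1 : δ < 1) {k : ℕ} (hk : 1 ≤ k) :
    1 ≤ logFactor δ k := by
  have h1 := two_le_two_div hδ hδ1
  have h2 : (1 : ℝ) ≤ k := by exact_mod_cast hk
  rw [logFactor, Real.le_log_iff_exp_le (by linarith)]
  linarith [Real.exp_one_lt_d9]

lemma exp_neg_mul_logFactor {δ : ℝ} (hδ : 0 < δ) (k j : ℕ) :
    Real.exp (-(j * logFactor δ k)) = 1 / ((k : ℝ) + 2 / δ) ^ j := by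
  have : 0 < (k : ℝ) + 2 / δ := by positivity
  rw [Real.exp_neg, Real.exp_nat_mul, logFactor, Real.exp_log this, one_div]

lemma regime_of_admissible {m : ℕ} {ε δ : ℝ} (hε : 0 < ε) (hδ : 0 < δ) (hδ1 : δ < 1)
    (hm : m0 ε δ < m) (hc : 200 * (m : ℝ) ^ (-(1 / 8) : ℝ) ≤ ε) {k : ℕ} (hk : 1 ≤ k)
    (hkε : (k : ℝ) ≤ 112 / ε ^ 2) : Regime m (nSamples m δ k) k (logFactor δ k) := by
  have hm0 : (0 : ℝ) < m := by exact_mod_cast lt_of_le_of_lt (Nat.zero_le _) hm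
  have hk1 : (1 : ℝ) ≤ k := by exact_mod_cast hk
  have hε2 : 0 < ε ^ 2 := by positivity
  have hkε' : k * ε ^ 2 ≤ 112 := (le_div_iff₀ hε2).mp hkε
  have hε112 : ε ^ 2 ≤ 112 := by nlinarith
  have hL1 := one_le_logFactor hδ hδ1 hk
  set L := logFactor δ k with hL
  -- δε²(k + 2/δ) = δkε² + 2ε² ≤ 112 + 224, within the 1123 provided by `m0`.
  have hLm : L ≤ √(m : ℝ) / 4 := by
    rw [hL, logFactor, Real.log_le_iff_le_exp (by positivity)]
    have h1 : 1123 * Real.exp (-(1 / 4) * √(m : ℝ)) ≤ δ * ε ^ 2 := by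
      refine le_trans ?_ (m0_spec hε hδ)
      have : √(m0 ε δ : ℝ) ≤ √(m : ℝ) := Real.sqrt_le_sqrt (by exact_mod_cast hm.le)
      gcongr 1123 * Real.exp ?_
      linarith
    have h2 : 1123 ≤ δ * ε ^ 2 * Real.exp (√(m : ℝ) / 4) := by
      have e : Real.exp (-(1 / 4) * √(m : ℝ)) * Real.exp (√(m : ℝ) / 4) = 1 := by
        rw [← Real.exp_add]; ring_nf; exact Real.exp_zero
      calc (1123 : ℝ) = 1123 * Real.exp (-(1 / 4) * √(m : ℝ)) * Real.exp (√(m : ℝ) / 4) := by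
            rw [mul_assoc, e, mul_one]
        _ ≤ _ := by gcongr
    have h3 : δ * ε ^ 2 * ((k : ℝ) + 2 / δ) = δ * (k * ε ^ 2) + 2 * ε ^ 2 := by field_simp
    have h4 : δ * (k * ε ^ 2) ≤ 1 * 112 := by gcongr
    have h5 : δ * ε ^ 2 * ((k : ℝ) + 2 / δ) ≤ δ * ε ^ 2 * Real.exp (√(m : ℝ) / 4) := by linarith
    exact le_of_mul_le_mul_left h5 (by positivity)
  set μ : ℝ := (m : ℝ) ^ (1 / 8 : ℝ) with hμ
  have hμ0 : 0 < μ := Real.rpow_pos_of_pos hm0 _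
  have hμ8 : μ ^ 8 = m := by
    rw [hμ, ← Real.rpow_natCast, ← Real.rpow_mul hm0.le]; norm_num
  have hμε : 200 ≤ ε * μ := by
    rw [Real.rpow_neg hm0.le, ← hμ, ← div_eq_mul_inv, div_le_iff₀ hμ0] at hc
    exact hc
  -- An epoch k ≥ 1 exists only if ε² ≤ 112; with εμ ≥ 200 this forces m to be large.
  have hε11 : ε ≤ 11 := by nlinarith
  have hμ18 : 18 ≤ μ := by nlinarith
  have hm10 : (10 : ℝ) ^ 10 ≤ m := by
    rw [← hμ8]
    calc (10 : ℝ) ^ 10 ≤ 18 ^ 8 := by norm_num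
      _ ≤ μ ^ 8 := by gcongr
  have hsqrtm : √(m : ℝ) = μ ^ 4 := by
    rw [← hμ8, show μ ^ 8 = (μ ^ 4) ^ 2 by ring, Real.sqrt_sq (by positivity)]
  have hsqrt : √(m * L) ≤ μ ^ 6 / 2 := by
    apply Real.sqrt_le_iff.mpr ⟨by positivity, ?_⟩
    calc m * L ≤ m * (μ ^ 4 / 4) := by rw [← hsqrtm]; gcongr
      _ = (μ ^ 6 / 2) ^ 2 := by rw [← hμ8]; ring
  have hkμ : k * 40000 ≤ 112 * μ ^ 2 := by
    calc (k : ℝ) * 40000 = k * 200 ^ 2 := by norm_num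
      _ ≤ k * (ε * μ) ^ 2 := by gcongr
      _ = k * ε ^ 2 * μ ^ 2 := by ring
      _ ≤ 112 * μ ^ 2 := by gcongr
  have hX : k * √(m * L) ≤ 0.0014 * m := by
    calc k * √(m * L) ≤ (112 * μ ^ 2 / 40000) * (μ ^ 6 / 2) := by
          gcongr; rw [le_div_iff₀ (by norm_num)]; exact hkμ
      _ = 0.0014 * m := by rw [← hμ8]; ring
  have hupper : (nSamples m δ k : ℝ) ≤ k * √(m * L) + 1 :=
    (Nat.ceil_lt_add_one (by positivity)).le
  exact ⟨hk, hL1, by linarith, by linarith, Nat.le_ceil _, hupper⟩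

lemma nSamples_mono {m : ℕ} {δ : ℝ} (hδ : 0 < δ) (hδ1 : δ < 1) : Monotone (nSamples m δ) := by
  intro a b hab
  have h2 := two_le_two_div hδ hδ1
  have hab' : (a : ℝ) ≤ b := by exact_mod_cast hab
  have ha : (0 : ℝ) ≤ a := Nat.cast_nonneg a
  apply Nat.ceil_mono
  gcongr

/-- Telescoping: 1/(i + a)² ≤ 1/(i - 1 + a) - 1/(i + a). -/
lemma sum_one_div_add_sq_le {a : ℝ} (ha : 0 < a) (K : ℕ) :
    ∑ i ∈ Finset.Ico 1 (K + 1), 1 / ((i : ℝ) + a) ^ 2 ≤ 1 / a - 1 / (K + a) := by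
  induction K with
  | zero => simp
  | succ K ih =>
    rw [Finset.sum_Ico_succ_top (by omega)]
    have h1 : 1 / (((K + 1 : ℕ) : ℝ) + a) ^ 2 ≤ 1 / (K + a) - 1 / ((K + 1 : ℕ) + a) := by
      have hK : (0 : ℝ) ≤ K := Nat.cast_nonneg K
      push_cast
      rw [div_sub_div _ _ (by positivity) (by positivity),
        div_le_div_iff₀ (by positivity) (by positivity)]
      nlinarith
    linarith

lemma sum_one_div_sq_le {δ : ℝ} (hδ : 0 < δ) (K : ℕ) :
    ∑ i ∈ Finset.Ico 1 (K + 1), 1 / ((i : ℝ) + 2 / δ) ^ 2 ≤ δ / 2 := by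
  refine (sum_one_div_add_sq_le (by positivity) K).trans ?_
  have : 0 ≤ 1 / ((K : ℝ) + 2 / δ) := by positivity
  rw [one_div_div]
  linarith

lemma log_ge {δ : ℝ} (hδ : 0 < δ) (hδ1 : δ < 1) {g : ℝ} (hg : 0 < g) (hg12 : g ≤ 12) :
    1 / 13 ≤ Real.log (1 / g + 1 / δ) := by
  have h1 : 1 / 12 ≤ 1 / g := one_div_le_one_div_of_le hg hg12
  have h2 : 1 ≤ 1 / δ := by rw [le_div_iff₀ hδ]; linarith
  have h3 : (13 / 12 : ℝ) ≤ 1 / g + 1 / δ := by linarith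
  have h4 := Real.one_sub_inv_le_log_of_pos (show (0 : ℝ) < 13 / 12 by norm_num)
  have h5 := Real.log_le_log (by norm_num) h3
  norm_num at h4
  linarith

/-- With A = 1/g + 1/δ, k + 2/δ ≤ 114A², and log 114 ≤ 5 ≤ 65 log A by `log_ge`. -/
lemma sqrt_logFactor_le {δ : ℝ} (hδ : 0 < δ) (hδ1 : δ < 1) {g : ℝ} (hg : 0 < g) (hg12 : g ≤ 12) {k : ℕ}
    (hk : (k : ℝ) ≤ 112 / g ^ 2) : √(logFactor δ k) ≤ 9 * √(Real.log (1 / g + 1 / δ)) := by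
  have hlog := log_ge hδ hδ1 hg hg12
  set A := 1 / g + 1 / δ with hA
  have h2 : 1 ≤ 1 / δ := by rw [le_div_iff₀ hδ]; linarith
  have hg0 : 0 < 1 / g := by positivity
  have hA1 : 1 ≤ A := by linarith
  have h3 : (k : ℝ) + 2 / δ ≤ 114 * A ^ 2 := by
    have e1 : 112 / g ^ 2 = 112 * (1 / g) ^ 2 := by field_simp
    have e2 : 2 / δ = 2 * (1 / δ) := by field_simp
    rw [e1] at hk
    rw [e2]
    nlinarith
  have h4 : logFactor δ k ≤ 81 * Real.log A := by
    have h5 : logFactor δ k ≤ Real.log (114 * A ^ 2) := Real.log_le_log (by positivity) h3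
    rw [Real.log_mul (by norm_num) (by positivity), Real.log_pow] at h5
    have h6 : Real.log 114 ≤ 5 := by
      rw [Real.log_le_iff_le_exp (by norm_num)]
      calc (114 : ℝ) ≤ 2.7 ^ 5 := by norm_num
        _ ≤ Real.exp 1 ^ 5 := by gcongr; linarith [Real.exp_one_gt_d9]
        _ = Real.exp 5 := by rw [← Real.exp_nat_mul]; norm_num
    push_cast at h5
    linarith
  calc √(logFactor δ k) ≤ √(81 * Real.log A) := Real.sqrt_le_sqrt h4
    _ = 9 * √(Real.log A) := by
      rw [Real.sqrt_mul (by norm_num), show (81 : ℝ) = 9 ^ 2 by norm_num,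
        Real.sqrt_sq (by norm_num)]

/-! ### The loop and its stopping epoch -/

variable {m : ℕ} [NeZero m] {δ : ℝ}

/-- The event that epoch `k` leads to the declaration of the alternative. -/
def Alarm (m : ℕ) [NeZero m] (δ : ℝ) (k : ℕ) (ω : ℕ → Fin m) : Prop :=
  cu m (nSamples m δ k) - (K1 (nSamples m δ k) ω : ℝ) > threshold m δ k

lemma measurableSet_alarm (k : ℕ) : MeasurableSet {ω : ℕ → Fin m | Alarm m δ k ω} :=
  measurableSet_lt measurable_const (measurable_const.sub (measurable_K1 _))

lemma loop_succ_of_alarm {ω : ℕ → Fin m} {k : ℕ} (h : Alarm m δ k ω) (r t : ℕ) :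
    loop m δ ω (r + 1) k t = (Decision.H1, nSamples m δ k) := by
  rw [loop]; exact if_pos h

lemma loop_succ_of_not_alarm {ω : ℕ → Fin m} {k : ℕ} (h : ¬ Alarm m δ k ω) (r t : ℕ) :
    loop m δ ω (r + 1) k t = loop m δ ω r (k + 1) (nSamples m δ k) := by
  rw [loop]; exact if_neg h

lemma loop_fst_eq_H0 {ω : ℕ → Fin m} (r k t : ℕ) (h : ∀ i, k ≤ i → i < k + r → ¬ Alarm m δ i ω) :
    (loop m δ ω r k t).1 = Decision.H0 := by
  induction r generalizing k t with
  | zero => rfl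
  | succ r ih =>
    rw [loop_succ_of_not_alarm (h k le_rfl (by omega))]
    exact ih _ _ fun i h1 h2 => h i (by omega) (by omega)

lemma loop_fst_eq_H1 {ω : ℕ → Fin m} (r k t : ℕ) {i : ℕ} (h1 : k ≤ i) (h2 : i < k + r)
    (h : Alarm m δ i ω) : (loop m δ ω r k t).1 = Decision.H1 := by
  induction r generalizing k t with
  | zero => omega
  | succ r ih =>
    by_cases hk : Alarm m δ k ω
    · rw [loop_succ_of_alarm hk]
    · rw [loop_succ_of_not_alarm hk]
      have : k ≠ i := by rintro rfl; exact hk h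
      exact ih _ _ (by omega) (by omega)

/-- `T` is the epoch at which sampling ends, by an alarm or by exhaustion. The form `r + 1` excludes
the empty loop, which returns `t`. -/
lemma exists_loop_snd_eq (ω : ℕ → Fin m) (r k t : ℕ) : ∃ T, k ≤ T ∧ T ≤ k + r ∧
    (loop m δ ω (r + 1) k t).2 = nSamples m δ T ∧ ∀ i, k ≤ i → i < T → ¬ Alarm m δ i ω := by
  induction r generalizing k t with
  | zero =>
    refine ⟨k, le_rfl, le_rfl, ?_, fun i _ _ => by omega⟩
    by_cases hk : Alarm m δ k ω
    · rw [loop_succ_of_alarm hk]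
    · rw [loop_succ_of_not_alarm hk, loop]
  | succ r ih =>
    by_cases hk : Alarm m δ k ω
    · exact ⟨k, le_rfl, by omega, by rw [loop_succ_of_alarm hk], fun i _ _ => by omega⟩
    · obtain ⟨T, h1, h2, h3, h4⟩ := ih (k + 1) (nSamples m δ k)
      refine ⟨T, by omega, by omega, by rw [loop_succ_of_not_alarm hk, h3], fun i hi hiT => ?_⟩
      rcases hi.eq_or_lt with rfl | hi
      · exact hk
      · exact h4 i hi hiT

lemma measurable_loop_snd (r k t : ℕ) :
    Measurable fun ω : ℕ → Fin m => (loop m δ ω r k t).2 := by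
  induction r generalizing k t with
  | zero => exact measurable_const
  | succ r ih =>
    classical
    have h : (fun ω : ℕ → Fin m => (loop m δ ω (r + 1) k t).2) = fun ω =>
        if Alarm m δ k ω then nSamples m δ k else (loop m δ ω r (k + 1) (nSamples m δ k)).2 := by
      ext ω
      split_ifs with hk
      · rw [loop_succ_of_alarm hk]
      · rw [loop_succ_of_not_alarm hk]
    rw [h]
    exact Measurable.ite (measurableSet_alarm k) measurable_const (ih _ _)

lemma nSamples_le (hδ : 0 < δ) (hδ1 : δ < 1) {k : ℕ} (hk : 1 ≤ k) :
    (nSamples m δ k : ℝ) ≤ 2 * (k * (√(m : ℝ) * √(logFactor δ k))) := by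
  have hL := one_le_logFactor hδ hδ1 hk
  have hm : (1 : ℝ) ≤ m := by exact_mod_cast NeZero.one_le
  have hk' : (1 : ℝ) ≤ k := by exact_mod_cast hk
  have h1 : 1 ≤ √(m * logFactor δ k) := Real.one_le_sqrt.mpr (by nlinarith)
  have h2 : (nSamples m δ k : ℝ) < k * √(m * logFactor δ k) + 1 :=
    Nat.ceil_lt_add_one (by positivity)
  rw [← Real.sqrt_mul (by linarith)]
  nlinarith

lemma exists_sampleCount_eq (ε : ℝ) (ω : ℕ → Fin m) (hK : 1 ≤ ⌊112 / ε ^ 2⌋₊) :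
    ∃ T, 1 ≤ T ∧ T ≤ ⌊112 / ε ^ 2⌋₊ ∧ sampleCount m ε δ ω = nSamples m δ T ∧
      ∀ i, 1 ≤ i → i < T → ¬ Alarm m δ i ω := by
  obtain ⟨r, hr⟩ := Nat.exists_eq_add_of_le' hK
  obtain ⟨T, h1, h2, h3, h4⟩ := exists_loop_snd_eq (δ := δ) ω r 1 0
  refine ⟨T, h1, by omega, ?_, h4⟩
  rw [sampleCount, run, hr, h3]

lemma sampleCount_eq_zero {ε : ℝ} (ω : ℕ → Fin m) (hK : ⌊112 / ε ^ 2⌋₊ = 0) :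
    sampleCount m ε δ ω = 0 := by
  rw [sampleCount, run, hK, loop]

lemma sampleCount_le (hδ : 0 < δ) (hδ1 : δ < 1) (ε : ℝ) (ω : ℕ → Fin m) :
    sampleCount m ε δ ω ≤ nSamples m δ ⌊112 / ε ^ 2⌋₊ := by
  rcases Nat.eq_zero_or_pos ⌊112 / ε ^ 2⌋₊ with h | h
  · rw [sampleCount_eq_zero ω h]; exact Nat.zero_le _
  · obtain ⟨T, -, h2, h3, -⟩ := exists_sampleCount_eq (δ := δ) ε ω h
    rw [h3]
    exact nSamples_mono hδ hδ1 h2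

lemma integrable_sampleCount (hδ : 0 < δ) (hδ1 : δ < 1) (ε : ℝ) (p : PMF (Fin m)) :
    Integrable (fun ω => (sampleCount m ε δ ω : ℝ)) (sampleLaw p) := by
  refine Integrable.of_bound (C := nSamples m δ ⌊112 / ε ^ 2⌋₊) ?_
    (Filter.Eventually.of_forall fun ω => ?_)
  · exact (Measurable.of_discrete.comp (measurable_loop_snd _ _ _)).aestronglyMeasurable
  · rw [Real.norm_natCast]
    exact_mod_cast sampleCount_le hδ hδ1 ε ω

/-- The number of samples, bounded by the epochs after epoch `k₀` that go by without an alarm. -/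
lemma sampleCount_le_add_sum (hδ : 0 < δ) (hδ1 : δ < 1) (ε : ℝ) (ω : ℕ → Fin m) {k₀ : ℕ}
    (hk₀ : 1 ≤ k₀) : (sampleCount m ε δ ω : ℝ) ≤ nSamples m δ k₀ +
      ∑ i ∈ Finset.Ico k₀ ⌊112 / ε ^ 2⌋₊,
        Set.indicator {ω | ¬ Alarm m δ i ω} (fun _ => (nSamples m δ (i + 1) : ℝ)) ω := by
  have hnn (i : ℕ) : 0 ≤ Set.indicator {ω : ℕ → Fin m | ¬ Alarm m δ i ω}
      (fun _ => (nSamples m δ (i + 1) : ℝ)) ω :=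
    Set.indicator_nonneg (fun _ _ => Nat.cast_nonneg _) _
  have hsum := Finset.sum_nonneg fun i (_ : i ∈ Finset.Ico k₀ ⌊112 / ε ^ 2⌋₊) => hnn i
  rcases Nat.eq_zero_or_pos ⌊112 / ε ^ 2⌋₊ with h | h
  · rw [sampleCount_eq_zero ω h]; push_cast; positivity
  · obtain ⟨T, -, h2, h3, h4⟩ := exists_sampleCount_eq (δ := δ) ε ω h
    rw [h3]
    rcases le_or_gt T k₀ with hT | hT
    · have : (nSamples m δ T : ℝ) ≤ nSamples m δ k₀ := by
        exact_mod_cast nSamples_mono hδ hδ1 hT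
      linarith
    -- Stopping at `i + 1 > k₀` means that epoch `i ≥ k₀` passed silently, so the summand of `i`
    -- alone covers the sample count.
    · obtain ⟨i, rfl⟩ := Nat.exists_eq_add_of_le' (show 1 ≤ T by omega)
      have h5 : ω ∈ {ω : ℕ → Fin m | ¬ Alarm m δ i ω} := h4 i (by omega) (by omega)
      have h6 := Finset.single_le_sum (fun i _ => hnn i)
        (Finset.mem_Ico.mpr ⟨by omega, by omega⟩ : i ∈ Finset.Ico k₀ ⌊112 / ε ^ 2⌋₊)
      rw [Set.indicator_of_mem h5] at h6
      have : (0 : ℝ) ≤ nSamples m δ k₀ := Nat.cast_nonneg _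
      linarith

/-! ### Error probabilities and expected sample size of the run -/

lemma distUnif_le_two (p : PMF (Fin m)) : distUnif p ≤ 2 := by
  have hm : (m : ℝ) ≠ 0 := NeZero.ne _
  calc distUnif p ≤ ∑ j, ((p j).toReal + 1 / (m : ℝ)) := Finset.sum_le_sum fun j _ => by
        have h1 : 0 ≤ 1 / (m : ℝ) := by positivity
        have h2 : 0 ≤ (p j).toReal := ENNReal.toReal_nonneg
        exact abs_le.mpr ⟨by linarith, by linarith⟩
    _ = 2 := by rw [Finset.sum_add_distrib, sum_toReal]; simp [hm]; norm_num

/-- The expected contribution of a late epoch to the number of samples. -/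
lemma nSamples_mul_exp_le (hδ : 0 < δ) (hδ1 : δ < 1) (i : ℕ) :
    (nSamples m δ (i + 1) : ℝ) * Real.exp (-(4 * logFactor δ i)) ≤
      2 * √(m : ℝ) * (1 / ((i : ℝ) + 2 / δ) ^ 2) := by
  have h2 := two_le_two_div hδ hδ1
  have h1 := exp_neg_mul_logFactor hδ i 4
  push_cast at h1
  rw [h1]
  set z : ℝ := i + 2 / δ with hz
  have hi : (0 : ℝ) ≤ i := Nat.cast_nonneg i
  have hz2 : 2 ≤ z := by linarith
  -- A crude bound suffices: the sample size is then of order z²√m against a miss probability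
  -- z^(-4).
  have h3 : √(logFactor δ (i + 1)) ≤ z := by
    apply Real.sqrt_le_iff.mpr ⟨by linarith, ?_⟩
    have := Real.log_le_sub_one_of_pos (show (0 : ℝ) < ((i + 1 : ℕ) : ℝ) + 2 / δ by positivity)
    rw [logFactor]
    push_cast at this ⊢
    nlinarith
  have h4 : (nSamples m δ (i + 1) : ℝ) ≤ 2 * √(m : ℝ) * z ^ 2 := by
    refine (nSamples_le hδ hδ1 (by omega)).trans ?_
    calc 2 * (((i + 1 : ℕ) : ℝ) * (√(m : ℝ) * √(logFactor δ (i + 1))))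
        ≤ 2 * (z * (√(m : ℝ) * z)) := by
          gcongr; push_cast; linarith
      _ = _ := by ring
  calc (nSamples m δ (i + 1) : ℝ) * (1 / z ^ 4) ≤ 2 * √(m : ℝ) * z ^ 2 * (1 / z ^ 4) := by gcongr
    _ = _ := by field_simp

lemma false_alarm_run_le {ε : ℝ} (hδ : 0 < δ) (hreg : ∀ k, 1 ≤ k → k ≤ ⌊112 / ε ^ 2⌋₊ →
      Regime m (nSamples m δ k) k (logFactor δ k)) :
    1 - δ ≤ (sampleLaw (unif m)).real {ω | output m ε δ ω = Decision.H0} := by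
  set K := ⌊112 / ε ^ 2⌋₊ with hK
  set A : Set (ℕ → Fin m) := ⋃ k ∈ Finset.Ico 1 (K + 1), {ω | Alarm m δ k ω} with hA
  have hAm : MeasurableSet A := Finset.measurableSet_biUnion _ fun k _ => measurableSet_alarm k
  have hle : (sampleLaw (unif m)).real A ≤ δ / 2 := by
    refine (measureReal_biUnion_finset_le _ _).trans
      ((Finset.sum_le_sum fun k hk => ?_).trans (sum_one_div_sq_le hδ K))
    have hk' := Finset.mem_Ico.mp hk
    refine (false_alarm_le (hreg k hk'.1 (by omega))).trans (le_of_eq ?_)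
    exact_mod_cast exp_neg_mul_logFactor hδ k 2
  have hsub : Aᶜ ⊆ {ω | output m ε δ ω = Decision.H0} := by
    intro ω hω
    refine loop_fst_eq_H0 _ _ _ fun i h1 h2 h => hω ?_
    exact Set.mem_biUnion (Finset.mem_coe.mpr (Finset.mem_Ico.mpr ⟨h1, by omega⟩)) h
  have := measureReal_mono (μ := sampleLaw (unif m)) hsub
  rw [probReal_compl_eq_one_sub hAm] at this
  linarith

/-- An alarm in any epoch leads to H1, so the miss probability of the last epoch bounds that of the
whole run. -/
lemma detection_run_ge {ε : ℝ} (hδ : 0 < δ) (hδ1 : δ < 1) (p : PMF (Fin m))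
    (hreg : Regime m (nSamples m δ ⌊112 / ε ^ 2⌋₊) ⌊112 / ε ^ 2⌋₊ (logFactor δ ⌊112 / ε ^ 2⌋₊))
    (hK : 14 ≤ ⌊112 / ε ^ 2⌋₊) (hKp : 56 ≤ ⌊112 / ε ^ 2⌋₊ * distUnif p ^ 2) :
    1 - δ ≤ (sampleLaw p).real {ω | output m ε δ ω = Decision.H1} := by
  set K := ⌊112 / ε ^ 2⌋₊ with hKdef
  have h1 : (sampleLaw p).real {ω | Alarm m δ K ω}ᶜ ≤ Real.exp (-(4 * logFactor δ K)) :=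
    missed_detection_le hreg p hK hKp
  have hsub : {ω | Alarm m δ K ω} ⊆ {ω | output m ε δ ω = Decision.H1} := fun ω hω =>
    loop_fst_eq_H1 _ _ _ (i := K) (by omega) (by omega) hω
  have h2 := measureReal_mono (μ := sampleLaw p) hsub
  rw [probReal_compl_eq_one_sub (measurableSet_alarm K)] at h1
  have h3 : Real.exp (-(4 * logFactor δ K)) ≤ δ := by
    have hL := one_le_logFactor hδ hδ1 hreg.one_le_k
    calc Real.exp (-(4 * logFactor δ K)) ≤ Real.exp (-((1 : ℕ) * logFactor δ K)) := by
          apply Real.exp_le_exp.mpr; push_cast; linarith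
      _ = 1 / ((K : ℝ) + 2 / δ) ^ 1 := exp_neg_mul_logFactor hδ K 1
      _ ≤ 1 / (1 / δ) := by
          rw [pow_one]
          apply one_div_le_one_div_of_le (by positivity)
          have : 0 < 1 / δ := by positivity
          have e : 2 / δ = 2 * (1 / δ) := by ring
          have : (0 : ℝ) ≤ K := Nat.cast_nonneg K
          rw [e]; linarith
      _ = δ := one_div_one_div δ
  linarith

lemma integral_sampleCount_le {ε : ℝ} (hδ : 0 < δ) (hδ1 : δ < 1) (p : PMF (Fin m)) {k₀ : ℕ}
    (hk₀ : 14 ≤ k₀) (hk₀p : 56 ≤ k₀ * distUnif p ^ 2)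
    (hreg : ∀ k, 1 ≤ k → k ≤ ⌊112 / ε ^ 2⌋₊ →
      Regime m (nSamples m δ k) k (logFactor δ k)) :
    ∫ ω, (sampleCount m ε δ ω : ℝ) ∂(sampleLaw p) ≤ nSamples m δ k₀ + √(m : ℝ) := by
  set K := ⌊112 / ε ^ 2⌋₊ with hK
  have hms (i : ℕ) : MeasurableSet {ω : ℕ → Fin m | ¬ Alarm m δ i ω} :=
    (measurableSet_alarm i).compl
  have hint (i : ℕ) : Integrable (Set.indicator {ω : ℕ → Fin m | ¬ Alarm m δ i ω}
      fun _ => (nSamples m δ (i + 1) : ℝ)) (sampleLaw p) :=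
    (integrable_const _).indicator (hms i)
  have hsumint := integrable_finsetSum (Finset.Ico k₀ K) fun i _ => hint i
  calc ∫ ω, (sampleCount m ε δ ω : ℝ) ∂(sampleLaw p)
      ≤ ∫ ω, ((nSamples m δ k₀ : ℝ) + ∑ i ∈ Finset.Ico k₀ K,
        Set.indicator {ω | ¬ Alarm m δ i ω} (fun _ => (nSamples m δ (i + 1) : ℝ)) ω)
          ∂(sampleLaw p) :=
        integral_mono (integrable_sampleCount hδ hδ1 ε p) ((integrable_const _).add hsumint)
          fun ω => sampleCount_le_add_sum hδ hδ1 ε ω (by omega)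
    _ = nSamples m δ k₀ + ∑ i ∈ Finset.Ico k₀ K,
        (sampleLaw p).real {ω | ¬ Alarm m δ i ω} * nSamples m δ (i + 1) := by
        rw [integral_add (integrable_const _) hsumint, integral_finsetSum _ fun i _ => hint i]
        simp [integral_indicator_const _ (hms _)]
    _ ≤ nSamples m δ k₀ + ∑ i ∈ Finset.Ico k₀ K,
        2 * √(m : ℝ) * (1 / ((i : ℝ) + 2 / δ) ^ 2) := by
        refine add_le_add le_rfl (Finset.sum_le_sum fun i hi => ?_)
        have hi' := Finset.mem_Ico.mp hi
        have hki : (k₀ : ℝ) ≤ i := by exact_mod_cast hi'.1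
        have h1 : (sampleLaw p).real {ω | ¬ Alarm m δ i ω} ≤ Real.exp (-(4 * logFactor δ i)) :=
          missed_detection_le (hreg i (by omega) (by omega)) p (by omega)
            (hk₀p.trans (by gcongr))
        refine le_trans ?_ (nSamples_mul_exp_le hδ hδ1 i)
        rw [mul_comm]
        gcongr
    _ ≤ nSamples m δ k₀ + 2 * √(m : ℝ) * (δ / 2) := by
        rw [← Finset.mul_sum]
        gcongr
        refine le_trans ?_ (sum_one_div_sq_le hδ K)
        refine Finset.sum_le_sum_of_subset_of_nonneg (fun i hi => ?_) fun i _ _ => by positivity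
        have hi' := Finset.mem_Ico.mp hi
        exact Finset.mem_Ico.mpr ⟨by omega, by omega⟩
    _ ≤ nSamples m δ k₀ + √(m : ℝ) := by
        have := Real.sqrt_nonneg (m : ℝ)
        nlinarith

end SCT

end

/-! ### The theorem -/

theorem theorem1 :
    ∃ c C : ℝ, 0 < c ∧ 0 < C ∧
      ∀ (m : ℕ) [NeZero m] (ε δ : ℝ), 0 < ε → 0 < δ → δ < 1 →
        SCT.m0 ε δ < m → c * (m : ℝ) ^ (-(1 / 8) : ℝ) ≤ ε →
        -- expected sample complexity under every alternative
        (∀ p ∈ SCT.alternatives m ε,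
          Integrable (fun ω => (SCT.sampleCount m ε δ ω : ℝ)) (SCT.sampleLaw p) ∧
          ∫ ω, (SCT.sampleCount m ε δ ω : ℝ) ∂(SCT.sampleLaw p) ≤
            C * (√(m : ℝ) / SCT.distUnif p ^ 2 *
              √(Real.log (1 / SCT.distUnif p + 1 / δ)))) ∧
        -- expected sample complexity under the null hypothesis
        (Integrable (fun ω => (SCT.sampleCount m ε δ ω : ℝ)) (SCT.sampleLaw (SCT.unif m)) ∧
          ∫ ω, (SCT.sampleCount m ε δ ω : ℝ) ∂(SCT.sampleLaw (SCT.unif m)) ≤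
            C * (√(m : ℝ) / ε ^ 2 * √(Real.log (1 / ε + 1 / δ)))) ∧
        -- probability of correct detection under both hypotheses
        (∀ p ∈ SCT.alternatives m ε,
          1 - δ ≤ (SCT.sampleLaw p).real {ω | SCT.output m ε δ ω = SCT.Decision.H1}) ∧
        1 - δ ≤ (SCT.sampleLaw (SCT.unif m)).real
          {ω | SCT.output m ε δ ω = SCT.Decision.H0} := by
  -- 200 is what `regime_of_admissible` needs; 2100 covers 1080 + 16 for the alternatives and 2 ·
  -- 112 · 9 = 2016 for the null.
  refine ⟨200, 2100, by norm_num, by norm_num, ?_⟩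
  intro m _ ε δ hε hδ hδ1 hm hc
  have hε2 : 0 < ε ^ 2 := by positivity
  have hreg (k : ℕ) (hk1 : 1 ≤ k) (hkK : k ≤ ⌊112 / ε ^ 2⌋₊) :
      SCT.Regime m (SCT.nSamples m δ k) k (SCT.logFactor δ k) :=
    SCT.regime_of_admissible hε hδ hδ1 hm hc hk1
      ((Nat.cast_le.mpr hkK).trans (Nat.floor_le (by positivity)))
  refine ⟨fun p hp => ⟨SCT.integrable_sampleCount hδ hδ1 ε p, ?_⟩,
    ⟨SCT.integrable_sampleCount hδ hδ1 ε _, ?_⟩, fun p hp => ?_,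
    SCT.false_alarm_run_le hδ hreg⟩
  · have hγ2 := SCT.distUnif_le_two p
    have hγ0 : 0 < SCT.distUnif p := hε.trans hp
    set γ := SCT.distUnif p with hγ
    have hγsq : 0 < γ ^ 2 := by positivity
    have hγ4 : γ ^ 2 ≤ 4 := by nlinarith
    have hk₀lo : 56 / γ ^ 2 ≤ (⌈56 / γ ^ 2⌉₊ : ℝ) := Nat.le_ceil _
    have hk₀hi : (⌈56 / γ ^ 2⌉₊ : ℝ) ≤ 60 / γ ^ 2 := by
      have h1 : (⌈56 / γ ^ 2⌉₊ : ℝ) < 56 / γ ^ 2 + 1 := Nat.ceil_lt_add_one (by positivity)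
      have h2 : 1 ≤ 4 / γ ^ 2 := by rw [le_div_iff₀ hγsq]; linarith
      have h3 : 60 / γ ^ 2 = 56 / γ ^ 2 + 4 / γ ^ 2 := by ring
      linarith
    set k₀ := ⌈56 / γ ^ 2⌉₊ with hk₀
    have hk₀14 : 14 ≤ k₀ := by
      have : 14 ≤ 56 / γ ^ 2 := by rw [le_div_iff₀ hγsq]; linarith
      have : (14 : ℝ) ≤ k₀ := by linarith
      exact_mod_cast this
    have hmain := SCT.integral_sampleCount_le (ε := ε) hδ hδ1 p hk₀14
      ((div_le_iff₀ hγsq).mp hk₀lo) hreg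
    have hn := SCT.nSamples_le (m := m) hδ hδ1 (show 1 ≤ k₀ by omega)
    have hsl := SCT.sqrt_logFactor_le hδ hδ1 hγ0 (by linarith)
      (hk₀hi.trans (div_le_div_of_nonneg_right (by norm_num) hγsq.le))
    have hlog := SCT.log_ge hδ hδ1 hγ0 (by linarith)
    set R := √(Real.log (1 / γ + 1 / δ)) with hR
    have hR4 : 1 / 4 ≤ R := by
      apply Real.le_sqrt_of_sq_le
      linarith
    have h1 : (SCT.nSamples m δ k₀ : ℝ) ≤ 1080 * (√(m : ℝ) / γ ^ 2 * R) := by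
      calc (SCT.nSamples m δ k₀ : ℝ) ≤ 2 * (k₀ * (√(m : ℝ) * √(SCT.logFactor δ k₀))) := hn
        _ ≤ 2 * (60 / γ ^ 2 * (√(m : ℝ) * (9 * R))) := by gcongr
        _ = _ := by ring
    have h2 : √(m : ℝ) ≤ 16 * (√(m : ℝ) / γ ^ 2 * R) := by
      calc √(m : ℝ) = 4 * (√(m : ℝ) * (1 / 4)) := by ring
        _ ≤ 4 * (√(m : ℝ) * R) := by gcongr
        _ = 16 * (√(m : ℝ) / 4 * R) := by ring
        _ ≤ _ := by gcongr
    have h3 : 0 ≤ √(m : ℝ) / γ ^ 2 * R := by positivity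
    linarith
  · have hbound : ∫ ω, (SCT.sampleCount m ε δ ω : ℝ) ∂(SCT.sampleLaw (SCT.unif m)) ≤
        SCT.nSamples m δ ⌊112 / ε ^ 2⌋₊ := by
      refine (integral_mono (SCT.integrable_sampleCount hδ hδ1 ε _) (integrable_const _)
        fun ω => Nat.cast_le.mpr (SCT.sampleCount_le hδ hδ1 ε ω)).trans (le_of_eq ?_)
      simp
    -- If ε² > 112, no epoch is run and no sample is taken.
    rcases Nat.eq_zero_or_pos ⌊112 / ε ^ 2⌋₊ with hK | hK
    · have : SCT.nSamples m δ 0 = 0 := by simp [SCT.nSamples]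
      rw [hK, this] at hbound
      refine hbound.trans ?_
      push_cast
      positivity
    · have hKle : (⌊112 / ε ^ 2⌋₊ : ℝ) ≤ 112 / ε ^ 2 := Nat.floor_le (by positivity)
      have hK1 : (1 : ℝ) ≤ ⌊112 / ε ^ 2⌋₊ := by exact_mod_cast hK
      have hε12 : ε ≤ 12 := by
        have := (le_div_iff₀ hε2).mp (hK1.trans hKle)
        nlinarith
      have hsl := SCT.sqrt_logFactor_le hδ hδ1 hε hε12 hKle
      set R := √(Real.log (1 / ε + 1 / δ)) with hR
      calc _ ≤ (SCT.nSamples m δ ⌊112 / ε ^ 2⌋₊ : ℝ) := hbound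
        _ ≤ 2 * (⌊112 / ε ^ 2⌋₊ * (√(m : ℝ) * √(SCT.logFactor δ ⌊112 / ε ^ 2⌋₊))) :=
          SCT.nSamples_le hδ hδ1 hK
        _ ≤ 2 * (112 / ε ^ 2 * (√(m : ℝ) * (9 * R))) := by gcongr
        _ = 2016 * (√(m : ℝ) / ε ^ 2 * R) := by ring
        _ ≤ _ := by gcongr; norm_num
  · have hγ2 := SCT.distUnif_le_two p
    have hεγ : ε < SCT.distUnif p := hp
    have hε4 : ε ^ 2 ≤ 4 := by nlinarith
    have h28 : 28 ≤ 112 / ε ^ 2 := by rw [le_div_iff₀ hε2]; linarith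
    have hfl := Nat.sub_one_lt_floor (112 / ε ^ 2)
    have hK14 : 14 ≤ ⌊112 / ε ^ 2⌋₊ := by
      have : (14 : ℝ) ≤ ⌊112 / ε ^ 2⌋₊ := by linarith
      exact_mod_cast this
    refine SCT.detection_run_ge hδ hδ1 p (hreg _ (by omega) le_rfl) hK14 ?_
    -- Rounding down loses less than 1, while half of 112/ε² is at least 14.
    have h56 : 56 / ε ^ 2 ≤ ⌊112 / ε ^ 2⌋₊ := by
      have : 112 / ε ^ 2 = 2 * (56 / ε ^ 2) := by ring
      linarith
    calc (56 : ℝ) ≤ ⌊112 / ε ^ 2⌋₊ * ε ^ 2 := (div_le_iff₀ hε2).mp h56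
      _ ≤ _ := by gcongr
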